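/- Let $1<\mu<2$. For $s_0>0$ and $K\in\mathbb N$ let $s_1,\dots,s_K$ be independent random variables, each Pareto distributed on $[s_0,\infty)$ with density $\frac{\mu}{s_0}\left(\frac{s}{s_0}\right)^{-(1+\mu)}$, and let $$\mathcal H=\frac{\sum_{j=1}^K s_j^2}{\left(\sum_{j=1}^K s_j\right)^2}$$ be the Herfindahl index. Write $\mathbb E[\,\cdot\,|K]$ for the expectation when there are $K$ sub-units. All moments $\mathbb E[\mathcal H^q|K]$, $q>0$, are finite, and for every $q>0$ with $q\neq\mu/2$ there are constants $C_1,C_2$ (depending only on $\mu$ and $q$) such that, to leading order as $K\to\infty$, $$\mathbb E[\mathcal H^q|K]=C_1K^{1-\mu}+C_2K^{2q\frac{1-\mu}{\mu}}+o\!\left(K^{\max\left(1-\mu,\;2q\frac{1-\mu}{\mu}\right)}\right).$$ If $q>\mu/2$, the first term dominates: $C_1>0$, $K^{2q(1-\mu)/\mu}=o(K^{1-\mu})$, and $\mathbb E[\mathcal H^q|K]/(C_1K^{1-\mu})\to1$. If $q<\mu/2$, the second term dominates: $C_2>0$, $K^{1-\mu}=o(K^{2q(1-\mu)/\mu})$,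 and $\mathbb E[\mathcal H^q|K]/(C_2K^{2q(1-\mu)/\mu})\to1$. In particular, the ratios $$\frac{\sqrt{\mathbb E[\mathcal H|K]}}{K^{(1-\mu)/2}}\qquad\text{and}\qquad\frac{\mathbb E[\sqrt{\mathcal H}\,|K]}{K^{(1-\mu)/\mu}}$$ tend, as $K\to\infty$, to positive real numbers depending only on $\mu$. -/

import Mathlib

open MeasureTheory Filter Topology

open scoped Asymptotics

noncomputable section

/-- The Herfindahl-Hirschman index of a finite family of sizes. -/
def herfindahl {ι : Type*} [Fintype ι] (s : ι → ℝ) : ℝ :=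
  (∑ j, s j ^ 2) / (∑ j, s j) ^ 2

/-- The joint law of the sub-unit sizes of a firm, conditional on its number `K` of sub-units:
they are independent, each Pareto distributed on `[s₀, ∞)` with density
`(μ / s₀) * (s / s₀) ^ (-(1 + μ))`. -/
def sizeLaw (s₀ μ : ℝ) (K : ℕ) : Measure (Fin K → ℝ) :=
  Measure.pi fun _ => ProbabilityTheory.paretoMeasure s₀ μ

/-- The `q`-th moment of the Herfindahl index conditional on the number `K` of sub-units. -/
def herfindahlMoment (s₀ μ q : ℝ) (K : ℕ) : ℝ :=
  ∫ s, herfindahl s ^ q ∂(sizeLaw s₀ μ K)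

end

section Herfindahl

open ProbabilityTheory

/-! Write S for the sum of the sizes and Q for the sum of their squares, so the index is Q / S². The
index is scale invariant, hence s₀ = 1 suffices. Since 1 < μ, the law of large numbers gives S ~ mK
with m = `paretoMean μ`. Since μ < 2, the squares have tail exponent μ/2 < 1, so Q is of order
K^(2/μ), with a limit law whose q-th moment is finite only for q < μ/2. This is the source of the
dichotomy.

For q > μ/2 the moment comes from rare configurations in which one unit has size of order K, an
event of probability of order K · K^(-μ). The identity H^q = Σ (s_j / S)² H^(q-1) and
exchangeability reduce the moment to K times the expected contribution of one unit
(`herfindahlMoment_succ`). Rescaling that unit by K produces the factor K^(1-μ). The other units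
enter only through S/K → m and Q/K² → 0, and dominated convergence gives the limit
`singleJumpCoeff`.

For q < μ/2 typical configurations dominate. The formula x^q = c⁻¹ ∫ (1 - e^(-tx)) t^(-1-q) dt turns
the q-th moment of K^(-2/μ) Q into an integral of 1 - (Laplace transform)^K, which converges to the
one for a stable law (`tendsto_integral_sum_sq_rpow`). Replacing (S/K)^(-2q) by m^(-2q) costs o(1),
because a slightly higher moment of the numerator stays bounded
(`tendsto_integral_mul_zero_of_rpow_bounded`). -/

/-! ### The Pareto law on the line: scaling, density and mean. -/

theorem paretoMeasure_eq_map_mul (s₀ μ : ℝ) (hs : 0 < s₀) :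
    paretoMeasure s₀ μ = (paretoMeasure 1 μ).map (fun x => s₀ * x) := by
  ext s hms
  have hm : Measurable fun x : ℝ => s₀ * x := measurable_const_mul s₀
  rw [Measure.map_apply hm hms, paretoMeasure, paretoMeasure, withDensity_apply _ hms,
    withDensity_apply _ (hm hms)]
  have hpdf : Measurable (paretoPDF s₀ μ) := (measurable_paretoPDFReal s₀ μ).ennreal_ofReal
  -- Lebesgue measure is |s₀| times its image under multiplication by s₀; this is the substitution
  -- in the density.
  conv_lhs => rw [← Real.smul_map_volume_mul_left hs.ne']
  rw [Measure.restrict_smul, lintegral_smul_measure, setLIntegral_map hms hpdf hm,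
    smul_eq_mul, ← lintegral_const_mul (f := fun x => paretoPDF s₀ μ (s₀ * x)) _ (hpdf.comp hm)]
  refine lintegral_congr fun x => ?_
  rw [paretoPDF_eq, paretoPDF_eq, ← ENNReal.ofReal_mul (abs_nonneg _), abs_of_pos hs]
  congr 1
  by_cases h : 1 ≤ x
  · have h' : s₀ ≤ s₀ * x := by nlinarith
    have e : s₀ ^ (-(μ + 1)) = (s₀ ^ μ * s₀)⁻¹ := by
      rw [Real.rpow_neg hs.le, Real.rpow_add hs, Real.rpow_one]
    rw [if_pos h, if_pos h', Real.mul_rpow hs.le (by linarith), Real.one_rpow, e]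
    have := (Real.rpow_pos_of_pos hs μ).ne'
    field_simp
  · have h' : ¬ s₀ ≤ s₀ * x := by nlinarith
    rw [if_neg h, if_neg h', mul_zero]

theorem ae_paretoMeasure_le (s₀ μ : ℝ) : ∀ᵐ x ∂(paretoMeasure s₀ μ), s₀ ≤ x := by
  have hpdf : Measurable (paretoPDF s₀ μ) := (measurable_paretoPDFReal s₀ μ).ennreal_ofReal
  rw [paretoMeasure, ae_withDensity_iff hpdf]
  refine ae_of_all _ fun x hx => ?_
  by_contra h
  exact hx (paretoPDF_of_lt (not_le.mp h))

theorem integral_paretoMeasure_one (μ : ℝ) (hμ : 0 < μ) (f : ℝ → ℝ) :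
    ∫ x, f x ∂(paretoMeasure 1 μ) = ∫ x in Set.Ioi 1, μ * x ^ (-(μ + 1)) * f x := by
  have hpdf : Measurable (paretoPDF 1 μ) := (measurable_paretoPDFReal 1 μ).ennreal_ofReal
  rw [paretoMeasure, integral_withDensity_eq_integral_toReal_smul hpdf
    (ae_of_all _ fun x => ENNReal.ofReal_lt_top), ← integral_Ici_eq_integral_Ioi,
    ← integral_indicator measurableSet_Ici]
  refine integral_congr_ae (ae_of_all _ fun x => ?_)
  simp only [smul_eq_mul, paretoPDF, ENNReal.toReal_ofReal (paretoPDFReal_nonneg zero_le_one hμ.le x)]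
  by_cases h : 1 ≤ x
  · rw [Set.indicator_of_mem (Set.mem_Ici.mpr h), paretoPDFReal, if_pos h, Real.one_rpow, mul_one]
  · rw [Set.indicator_of_notMem (by simpa using h), paretoPDFReal, if_neg h, zero_mul]

/-- The power-law density is homogeneous, so measuring sizes in units of a costs a factor a^(-μ) and
moves the lower cutoff to 1/a. It serves with a = n + 1 and with a = 1/√t; in both limits the cutoff
disappears. Keeping the cutoff as an indicator fixes the domain for dominated convergence. -/
theorem integral_paretoMeasure_one_eq_rescaled (μ : ℝ) (hμ : 0 < μ) (f : ℝ → ℝ) {a : ℝ}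
    (ha : 0 < a) :
    ∫ x, f x ∂(paretoMeasure 1 μ) =
      a ^ (-μ) * ∫ x in Set.Ioi 0,
        (Set.Ioi a⁻¹).indicator (fun x => μ * x ^ (-(μ + 1)) * f (a * x)) x := by
  have hI : Set.Ioi (0 : ℝ) ∩ Set.Ioi a⁻¹ = Set.Ioi a⁻¹ :=
    Set.inter_eq_right.mpr (Set.Ioi_subset_Ioi (inv_pos.mpr ha).le)
  have h := integral_comp_mul_left_Ioi (fun x => μ * x ^ (-(μ + 1)) * f x) a⁻¹ ha
  rw [mul_inv_cancel₀ ha.ne'] at h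
  rw [integral_paretoMeasure_one μ hμ, setIntegral_indicator measurableSet_Ioi, hI]
  have h2 : ∫ x in Set.Ioi 1, μ * x ^ (-(μ + 1)) * f x =
      a * ∫ x in Set.Ioi a⁻¹, μ * (a * x) ^ (-(μ + 1)) * f (a * x) := by
    rw [h, smul_eq_mul, mul_inv_cancel_left₀ ha.ne']
  rw [h2, ← integral_const_mul, ← integral_const_mul]
  refine setIntegral_congr_fun measurableSet_Ioi fun x hx => ?_
  have hx0 : 0 < x := (inv_pos.mpr ha).trans hx
  have e : a ^ (-(μ + 1)) = a ^ (-μ) * a⁻¹ := by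
    rw [neg_add, Real.rpow_add ha, Real.rpow_neg_one]
  simp only [Real.mul_rpow ha.le hx0.le, e]
  field_simp

theorem integrable_id_paretoMeasure_one (μ : ℝ) (hμ : 1 < μ) :
    Integrable (fun x : ℝ => x) (paretoMeasure 1 μ) := by
  have hpdf : Measurable (paretoPDF 1 μ) := (measurable_paretoPDFReal 1 μ).ennreal_ofReal
  rw [paretoMeasure, integrable_withDensity_iff hpdf (ae_of_all _ fun x => ENNReal.ofReal_lt_top)]
  have h1 : IntegrableOn (fun x : ℝ => μ * x ^ (-μ)) (Set.Ici 1) :=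
    (integrableOn_Ici_iff_integrableOn_Ioi).mpr
      ((integrableOn_Ioi_rpow_of_lt (by linarith) one_pos).const_mul _)
  refine ((integrable_indicator_iff measurableSet_Ici).mpr h1).congr (ae_of_all _ fun x => ?_)
  simp only [paretoPDF, ENNReal.toReal_ofReal (paretoPDFReal_nonneg zero_le_one
    (by linarith : (0:ℝ) ≤ μ) x)]
  by_cases h : 1 ≤ x
  · have hx : 0 < x := by linarith
    rw [Set.indicator_of_mem (Set.mem_Ici.mpr h), paretoPDFReal, if_pos h, Real.one_rpow, mul_one,
      neg_add, Real.rpow_add hx, Real.rpow_neg_one]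
    field_simp
  · rw [Set.indicator_of_notMem (by simpa using h), paretoPDFReal, if_neg h, mul_zero]

/-! ### Mean size, infinite independent sequence and the law of large numbers. -/

/-- The mean size of a sub-unit with scale one. -/
noncomputable def paretoMean (μ : ℝ) : ℝ := ∫ x, x ∂(paretoMeasure 1 μ)

theorem one_le_paretoMean (μ : ℝ) (hμ : 1 < μ) : 1 ≤ paretoMean μ := by
  have := isProbabilityMeasure_paretoMeasure one_pos (by linarith : 0 < μ)
  have h := integral_mono_ae (integrable_const (1 : ℝ)) (integrable_id_paretoMeasure_one μ hμ)
    (ae_paretoMeasure_le 1 μ)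
  simpa [paretoMean] using h

/-- The law of an infinite sequence of independent sizes with scale one. -/
noncomputable def sequenceLaw (μ : ℝ) : Measure (ℕ → ℝ) :=
  Measure.infinitePi fun _ => paretoMeasure 1 μ

theorem isProbabilityMeasure_sequenceLaw (μ : ℝ) (hμ : 0 < μ) :
    IsProbabilityMeasure (sequenceLaw μ) := by
  have := isProbabilityMeasure_paretoMeasure one_pos hμ
  unfold sequenceLaw
  infer_instance

theorem measurePreserving_eval_sequenceLaw (μ : ℝ) (hμ : 0 < μ) (i : ℕ) :
    MeasurePreserving (fun ω : ℕ → ℝ => ω i) (sequenceLaw μ) (paretoMeasure 1 μ) := by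
  have := isProbabilityMeasure_paretoMeasure one_pos hμ
  exact measurePreserving_eval_infinitePi (fun _ => paretoMeasure 1 μ) i

theorem iIndepFun_eval_sequenceLaw (μ : ℝ) (hμ : 0 < μ) :
    iIndepFun (fun (i : ℕ) (ω : ℕ → ℝ) => ω i) (sequenceLaw μ) := by
  have := isProbabilityMeasure_paretoMeasure one_pos hμ
  exact iIndepFun_infinitePi (P := fun _ : ℕ => paretoMeasure 1 μ) (X := fun _ x => x)
    fun _ => measurable_id

theorem identDistrib_eval_sequenceLaw (μ : ℝ) (hμ : 0 < μ) (i : ℕ) :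
    IdentDistrib (fun ω : ℕ → ℝ => ω i) (fun ω => ω 0) (sequenceLaw μ) (sequenceLaw μ) where
  aemeasurable_fst := (measurable_pi_apply i).aemeasurable
  aemeasurable_snd := (measurable_pi_apply 0).aemeasurable
  map_eq := by
    rw [(measurePreserving_eval_sequenceLaw μ hμ i).map_eq,
      (measurePreserving_eval_sequenceLaw μ hμ 0).map_eq]

theorem ae_sequenceLaw_one_le (μ : ℝ) (hμ : 0 < μ) :
    ∀ᵐ ω ∂(sequenceLaw μ), ∀ i, 1 ≤ ω i :=
  ae_all_iff.mpr fun i =>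
    (measurePreserving_eval_sequenceLaw μ hμ i).quasiMeasurePreserving.ae
      (ae_paretoMeasure_le 1 μ)

/-- This places the laws for all K on one probability space, where almost sure convergence makes
sense. -/
theorem measurePreserving_sequenceLaw_sizeLaw (μ : ℝ) (hμ : 0 < μ) (K : ℕ) :
    MeasurePreserving (fun (ω : ℕ → ℝ) (i : Fin K) => ω i) (sequenceLaw μ) (sizeLaw 1 μ K) := by
  have := isProbabilityMeasure_sequenceLaw μ hμ
  have hm : Measurable fun (ω : ℕ → ℝ) (i : Fin K) => ω i := by fun_prop
  refine ⟨hm, ?_⟩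
  have h : iIndepFun (fun (i : Fin K) (ω : ℕ → ℝ) => ω i) (sequenceLaw μ) :=
    (iIndepFun_eval_sequenceLaw μ hμ).precomp (g := fun i : Fin K => (i : ℕ))
    Fin.val_injective
  rw [iIndepFun_iff_map_fun_eq_pi_map fun i : Fin K => (measurable_pi_apply (i : ℕ)).aemeasurable] at h
  rw [sizeLaw]
  refine h.trans ?_
  congr 1
  funext i
  exact (measurePreserving_eval_sequenceLaw μ hμ i).map_eq

theorem integrable_eval_zero_sequenceLaw (μ : ℝ) (hμ : 1 < μ) :
    Integrable (fun ω : ℕ → ℝ => ω 0) (sequenceLaw μ) :=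
  (measurePreserving_eval_sequenceLaw μ (by linarith) 0).integrable_comp_of_integrable
    (integrable_id_paretoMeasure_one μ hμ)

theorem integral_eval_zero_sequenceLaw (μ : ℝ) (hμ : 1 < μ) :
    ∫ ω, ω 0 ∂(sequenceLaw μ) = paretoMean μ := by
  have h := (measurePreserving_eval_sequenceLaw μ (by linarith) 0).map_eq
  rw [paretoMean, ← h, integral_map (measurable_pi_apply 0).aemeasurable
    (by exact measurable_id.aestronglyMeasurable)]

theorem ae_tendsto_average_sequenceLaw (μ : ℝ) (hμ : 1 < μ) :
    ∀ᵐ ω ∂(sequenceLaw μ), Tendsto (fun n : ℕ => (∑ i ∈ Finset.range n, (ω i : ℝ)) / (n : ℝ)) atTop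
      (𝓝 (paretoMean μ)) := by
  have h0 : 0 < μ := by linarith
  have h := strong_law_ae_real (μ := sequenceLaw μ) (fun (i : ℕ) (ω : ℕ → ℝ) => ω i)
    (integrable_eval_zero_sequenceLaw μ hμ)
    (fun i j hij => (iIndepFun_eval_sequenceLaw μ h0).indepFun hij)
    (fun i => identDistrib_eval_sequenceLaw μ h0 i)
  rwa [integral_eval_zero_sequenceLaw μ hμ] at h

/-! ### Scale invariance and boundedness of the index. -/

theorem sizeLaw_eq_map_mul (s₀ μ : ℝ) (hs : 0 < s₀) (hμ : 0 < μ) (K : ℕ) :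
    sizeLaw s₀ μ K = (sizeLaw 1 μ K).map (fun s i => s₀ * s i) := by
  have := isProbabilityMeasure_paretoMeasure one_pos hμ
  have := isProbabilityMeasure_paretoMeasure hs hμ
  have h : ∀ _ : Fin K, SigmaFinite ((paretoMeasure 1 μ).map fun x => s₀ * x) := fun _ => by
    rw [← paretoMeasure_eq_map_mul s₀ μ hs]; infer_instance
  rw [sizeLaw, sizeLaw, Measure.pi_map_pi (hμ := h) (f := fun _ x => s₀ * x)
    fun _ => (measurable_const_mul s₀).aemeasurable]
  simp_rw [← paretoMeasure_eq_map_mul s₀ μ hs]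

theorem herfindahl_const_mul {ι : Type*} [Fintype ι] (a : ℝ) (ha : a ≠ 0) (s : ι → ℝ) :
    herfindahl (fun i => a * s i) = herfindahl s := by
  simp only [herfindahl, mul_pow, ← Finset.mul_sum]
  exact mul_div_mul_left _ _ (pow_ne_zero 2 ha)

theorem measurable_herfindahl (ι : Type*) [Fintype ι] :
    Measurable (herfindahl : (ι → ℝ) → ℝ) := by
  unfold herfindahl
  fun_prop

theorem herfindahl_nonneg {ι : Type*} [Fintype ι] (s : ι → ℝ) : 0 ≤ herfindahl s :=
  div_nonneg (Finset.sum_nonneg fun _ _ => sq_nonneg _) (sq_nonneg _)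

theorem sum_sq_le_sq_sum {ι : Type*} (t : Finset ι) (s : ι → ℝ) (hs : ∀ i ∈ t, 0 ≤ s i) :
    ∑ i ∈ t, s i ^ 2 ≤ (∑ i ∈ t, s i) ^ 2 :=
  Finset.sum_sq_le_sq_sum_of_nonneg hs

theorem herfindahl_le_one {ι : Type*} [Fintype ι] (s : ι → ℝ) (hs : ∀ i, 0 ≤ s i) :
    herfindahl s ≤ 1 :=
  div_le_one_of_le₀ (sum_sq_le_sq_sum _ s fun i _ => hs i) (sq_nonneg _)

theorem ae_sizeLaw_le (s₀ μ : ℝ) (hs : 0 < s₀) (hμ : 0 < μ) (K : ℕ) :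
    ∀ᵐ s ∂(sizeLaw s₀ μ K), ∀ i, s₀ ≤ s i := by
  have := isProbabilityMeasure_paretoMeasure hs hμ
  exact ae_all_iff.mpr fun i =>
    (measurePreserving_eval (fun _ : Fin K => paretoMeasure s₀ μ) i).quasiMeasurePreserving.ae
      (ae_paretoMeasure_le s₀ μ)

theorem isProbabilityMeasure_sizeLaw (s₀ μ : ℝ) (hs : 0 < s₀) (hμ : 0 < μ) (K : ℕ) :
    IsProbabilityMeasure (sizeLaw s₀ μ K) := by
  have := isProbabilityMeasure_paretoMeasure hs hμ
  unfold sizeLaw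
  infer_instance

/-- Sizes are almost surely positive, so the index lies in [0, 1]; for K = 0 it is 0 / 0 = 0. -/
theorem integrable_herfindahl_rpow (s₀ μ q : ℝ) (hs : 0 < s₀) (hμ : 0 < μ) (hq : 0 < q) (K : ℕ) :
    Integrable (fun s : Fin K → ℝ => herfindahl s ^ q) (sizeLaw s₀ μ K) := by
  have := isProbabilityMeasure_sizeLaw s₀ μ hs hμ K
  refine Integrable.of_bound ((measurable_herfindahl _).pow_const q).aestronglyMeasurable 1 ?_
  filter_upwards [ae_sizeLaw_le s₀ μ hs hμ K] with s h
  rw [Real.norm_of_nonneg (Real.rpow_nonneg (herfindahl_nonneg s) q)]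
  exact Real.rpow_le_one (herfindahl_nonneg s)
    (herfindahl_le_one s fun i => hs.le.trans (h i)) hq.le

theorem herfindahlMoment_eq_scale_one (s₀ μ q : ℝ) (hs : 0 < s₀) (hμ : 0 < μ) (K : ℕ) :
    herfindahlMoment s₀ μ q K = herfindahlMoment 1 μ q K := by
  rw [herfindahlMoment, sizeLaw_eq_map_mul s₀ μ hs hμ, integral_map
    (by have : Measurable fun (s : Fin K → ℝ) (i : Fin K) => s₀ * s i := by fun_prop
        exact this.aemeasurable)
    ((measurable_herfindahl _).pow_const q).aestronglyMeasurable]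
  simp only [herfindahl_const_mul s₀ hs.ne', herfindahlMoment]

theorem integral_sizeLaw_eq_sequenceLaw (μ : ℝ) (hμ : 0 < μ) {K : ℕ} {g : (Fin K → ℝ) → ℝ}
    (hg : Measurable g) :
    ∫ s, g s ∂(sizeLaw 1 μ K) = ∫ ω, g (fun i => ω i) ∂(sequenceLaw μ) := by
  have h := measurePreserving_sequenceLaw_sizeLaw μ hμ K
  rw [← h.map_eq, integral_map h.measurable.aemeasurable hg.aestronglyMeasurable]

/-! ### Two analytic tools: power-law comparison and negligible sums of squares. -/

theorem integrableOn_Ioi_zero_of_le_rpow {f : ℝ → ℝ} (hf : Measurable f) {a b C D : ℝ}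
    (ha : -1 < a) (hb : b < -1) (h0 : ∀ x, 0 < x → 0 ≤ f x)
    (h1 : ∀ x, 0 < x → x ≤ 1 → f x ≤ C * x ^ a) (h2 : ∀ x, 1 < x → f x ≤ D * x ^ b) :
    IntegrableOn f (Set.Ioi 0) := by
  rw [← Set.Ioc_union_Ioi_eq_Ioi zero_le_one]
  refine IntegrableOn.union ?_ ?_
  · have h : IntegrableOn (fun x : ℝ => C * x ^ a) (Set.Ioc 0 1) := by
      rw [integrableOn_Ioc_iff_integrableOn_Ioo]
      exact ((intervalIntegral.integrableOn_Ioo_rpow_iff one_pos).mpr ha).const_mul C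
    refine h.mono' hf.aestronglyMeasurable ((ae_restrict_iff' measurableSet_Ioc).mpr
      (ae_of_all _ fun x hx => ?_))
    rw [Real.norm_of_nonneg (h0 x hx.1)]
    exact h1 x hx.1 hx.2
  · have h : IntegrableOn (fun x : ℝ => D * x ^ b) (Set.Ioi 1) :=
      (integrableOn_Ioi_rpow_of_lt hb one_pos).const_mul D
    refine h.mono' hf.aestronglyMeasurable ((ae_restrict_iff' measurableSet_Ioi).mpr
      (ae_of_all _ fun x (hx : 1 < x) => ?_))
    rw [Real.norm_of_nonneg (h0 x (one_pos.trans hx))]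
    exact h2 x hx

/-- Convergence of averages forces a_n = o(n), hence a_n² = o(a_n (n + 1)). Summing, Σ a_i² is
negligible against Σ a_i (i + 1) ≤ (n + 1) Σ a_i = O(n²). The argument is pathwise and needs no
second moment, which is infinite here. -/
theorem tendsto_sum_sq_div_sq_of_tendsto_average {a : ℕ → ℝ} (ha : ∀ i, 1 ≤ a i) {m : ℝ}
    (h : Tendsto (fun n : ℕ => (∑ i ∈ Finset.range n, a i) / (n : ℝ)) atTop (𝓝 m)) :
    Tendsto (fun n : ℕ => (∑ i ∈ Finset.range n, a i ^ 2) / ((n : ℝ) + 1) ^ 2) atTop (𝓝 0) := by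
  have hr : Tendsto (fun n : ℕ => (n : ℝ) / ((n : ℝ) + 1)) atTop (𝓝 1) :=
    tendsto_natCast_div_add_atTop (1 : ℝ)
  have hS : Tendsto (fun n : ℕ => (∑ i ∈ Finset.range n, a i) / ((n : ℝ) + 1)) atTop (𝓝 m) := by
    have := h.mul hr
    rw [mul_one] at this
    refine this.congr' ?_
    filter_upwards [eventually_gt_atTop 0] with n hn
    have : (0 : ℝ) < n := Nat.cast_pos.mpr hn
    field_simp
  have hS' := (tendsto_add_atTop_iff_nat 1).mpr h
  -- The term a_n / (n + 1) is the difference of two sequences with the same limit m.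
  have hlast : Tendsto (fun n : ℕ => a n / ((n : ℝ) + 1)) atTop (𝓝 0) := by
    have := hS'.sub hS
    rw [sub_self] at this
    refine this.congr fun n => ?_
    rw [Finset.sum_range_succ]
    push_cast
    ring
  have hlo : a =o[atTop] fun n : ℕ => (n : ℝ) + 1 :=
    (Asymptotics.isLittleO_iff_tendsto' (Eventually.of_forall fun n h => by
      have : (0 : ℝ) ≤ n := n.cast_nonneg
      linarith)).mpr hlast
  have hlo2 : (fun n => a n ^ 2) =o[atTop] fun n : ℕ => a n * ((n : ℝ) + 1) := by
    simpa [pow_two] using (Asymptotics.isBigO_refl a atTop).mul_isLittleO hlo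
  have hg : ∀ n : ℕ, (1 : ℝ) ≤ a n * ((n : ℝ) + 1) := fun n => by
    have : (0 : ℝ) ≤ n := n.cast_nonneg
    nlinarith [ha n]
  have hdiv : Tendsto (fun n : ℕ => ∑ i ∈ Finset.range n, a i * ((i : ℝ) + 1)) atTop atTop := by
    refine tendsto_atTop_mono (fun n => ?_) tendsto_natCast_atTop_atTop
    calc (n : ℝ) = ∑ i ∈ Finset.range n, (1 : ℝ) := by simp
      _ ≤ _ := Finset.sum_le_sum fun i _ => hg i
  have hsum := hlo2.sum_range (fun n => zero_le_one.trans (hg n)) hdiv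
  have hbig : (fun n : ℕ => ∑ i ∈ Finset.range n, a i * ((i : ℝ) + 1)) =O[atTop]
      fun n : ℕ => ((n : ℝ) + 1) ^ 2 := by
    have h1 : (fun n : ℕ => ∑ i ∈ Finset.range n, a i) =O[atTop] fun n : ℕ => (n : ℝ) + 1 :=
      Asymptotics.isBigO_of_div_tendsto_nhds (Eventually.of_forall fun n h => by
        have : (0 : ℝ) ≤ n := n.cast_nonneg
        linarith) m hS
    have h2 := h1.mul (Asymptotics.isBigO_refl (fun n : ℕ => (n : ℝ) + 1) atTop)
    refine (Asymptotics.IsBigO.of_bound 1 (Eventually.of_forall fun n => ?_)).trans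
      (by simpa [pow_two] using h2)
    rw [one_mul, Finset.sum_mul]
    have hn : ∀ i ∈ Finset.range n, 0 ≤ a i * ((i : ℝ) + 1) := fun i _ =>
      zero_le_one.trans (hg i)
    have hle : ∀ i ∈ Finset.range n, a i * ((i : ℝ) + 1) ≤ a i * ((n : ℝ) + 1) := fun i hi => by
      have : (i : ℝ) ≤ n := Nat.cast_le.mpr (Finset.mem_range.mp hi).le
      have := ha i
      gcongr
    rw [Real.norm_of_nonneg (Finset.sum_nonneg hn), Real.norm_of_nonneg
      (Finset.sum_nonneg fun i hi => (hn i hi).trans (hle i hi))]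
    exact Finset.sum_le_sum hle
  exact (hsum.trans_isBigO hbig).tendsto_div_nhds_zero

/-! ### The regime q > μ/2: one unit of size comparable to the total. -/

/-- The contribution to the `q`-th power of the Herfindahl index of a sub-unit of size `x`, when
the sizes of the other sub-units have sum `u` and sum of squares `v`. -/
noncomputable def unitContribution (q x u v : ℝ) : ℝ :=
  (x / (x + u)) ^ 2 * ((x ^ 2 + v) / (x + u) ^ 2) ^ (q - 1)

theorem unitContribution_nonneg (q x u : ℝ) {v : ℝ} (hv : 0 ≤ v) :
    0 ≤ unitContribution q x u v :=
  mul_nonneg (sq_nonneg _) (Real.rpow_nonneg (div_nonneg (by positivity) (sq_nonneg _)) _)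

theorem unitContribution_mul (q x u v : ℝ) {a : ℝ} (ha : 0 < a) :
    unitContribution q (a * x) u v = unitContribution q x (u / a) (v / a ^ 2) := by
  have e : a * x + u = a * (x + u / a) := by field_simp
  have e2 : (a * x) ^ 2 + v = a ^ 2 * (x ^ 2 + v / a ^ 2) := by field_simp
  rw [unitContribution, unitContribution, e, e2, mul_pow, mul_div_mul_left _ _ ha.ne',
    mul_div_mul_left _ _ (pow_pos ha 2).ne']

/-- Let y = (x / (x + u))² and let h be the index, so y ≤ h ≤ 1. If q ≥ 1 then y h^(q-1) ≤ y; if q <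
1 the negative exponent gives y h^(q-1) ≤ y^q. The bound no longer involves v, and u only through
its lower bound c. -/
theorem unitContribution_le {q x u v c : ℝ} (hq : 0 < q) (hx : 0 < x) (hc : 0 < c)
    (hu : c ≤ u) (hv : 0 ≤ v) (hvu : v ≤ u ^ 2) :
    unitContribution q x u v ≤ ((x / (x + c)) ^ 2) ^ (min q 1) := by
  have hu0 : 0 < u := hc.trans_le hu
  have hy0 : 0 < (x / (x + u)) ^ 2 := by positivity
  have hyh : (x / (x + u)) ^ 2 ≤ (x ^ 2 + v) / (x + u) ^ 2 := by
    rw [div_pow]; gcongr; linarith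
  have hh1 : (x ^ 2 + v) / (x + u) ^ 2 ≤ 1 := by
    rw [div_le_one (by positivity)]; nlinarith [mul_pos hx hu0]
  have hyc : (x / (x + u)) ^ 2 ≤ (x / (x + c)) ^ 2 := by gcongr
  refine le_trans ?_ (Real.rpow_le_rpow hy0.le hyc (le_min hq.le zero_le_one))
  unfold unitContribution
  rcases le_or_gt 1 q with h | h
  · rw [min_eq_right h, Real.rpow_one]
    exact mul_le_of_le_one_right hy0.le
      (Real.rpow_le_one (hy0.le.trans hyh) hh1 (by linarith))
  · rw [min_eq_left h.le]
    calc _ ≤ (x / (x + u)) ^ 2 * ((x / (x + u)) ^ 2) ^ (q - 1) := by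
          gcongr ?_ * ?_
          exact Real.rpow_le_rpow_of_nonpos hy0 hyh (by linarith)
      _ = _ := by rw [Real.rpow_sub_one hy0.ne']; field_simp

/-- The summands are (s_j / S)² H^(q-1), and the squared shares sum to H. -/
theorem herfindahl_rpow_eq_sum_unitContribution (q : ℝ) {n : ℕ} (s : Fin (n + 1) → ℝ)
    (hs : ∀ i, 1 ≤ s i) :
    herfindahl s ^ q = ∑ j, unitContribution q (s j) (∑ i, s (j.succAbove i))
      (∑ i, s (j.succAbove i) ^ 2) := by
  have hS : 0 < ∑ j, s j := Finset.sum_pos (fun i _ => one_pos.trans_le (hs i)) ⟨0, by simp⟩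
  have hN : 0 < ∑ j, s j ^ 2 :=
    Finset.sum_pos (fun i _ => pow_pos (one_pos.trans_le (hs i)) 2) ⟨0, by simp⟩
  have hH : 0 < herfindahl s := div_pos hN (pow_pos hS 2)
  have hterm : ∀ j, unitContribution q (s j) (∑ i, s (j.succAbove i))
      (∑ i, s (j.succAbove i) ^ 2) = s j ^ 2 / (∑ j, s j) ^ 2 * herfindahl s ^ (q - 1) := by
    intro j
    rw [unitContribution, ← Fin.sum_univ_succAbove s j,
      ← Fin.sum_univ_succAbove (fun i => s i ^ 2) j, div_pow, herfindahl]
  simp_rw [hterm]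
  rw [← Finset.sum_mul, ← Finset.sum_div]
  change _ = herfindahl s * _
  rw [Real.rpow_sub_one hH.ne', mul_div_cancel₀ _ hH.ne']

theorem measurable_unitContribution (q : ℝ) {α : Type*} [MeasurableSpace α] {x u v : α → ℝ}
    (hx : Measurable x) (hu : Measurable u) (hv : Measurable v) :
    Measurable fun a => unitContribution q (x a) (u a) (v a) := by
  unfold unitContribution
  fun_prop

/-- Exchangeability: the n + 1 contributions have equal means, and Fubini separates the
distinguished unit from the n others. -/
theorem herfindahlMoment_succ (μ q : ℝ) (hμ : 0 < μ) (hq : 0 < q) (n : ℕ) :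
    herfindahlMoment 1 μ q (n + 1) = (n + 1) * ∫ ω, ∫ x, unitContribution q x
      (∑ i ∈ Finset.range n, ω i) (∑ i ∈ Finset.range n, ω i ^ 2) ∂(paretoMeasure 1 μ)
        ∂(sequenceLaw μ) := by
  have := isProbabilityMeasure_paretoMeasure one_pos hμ
  have := isProbabilityMeasure_sizeLaw 1 μ one_pos hμ (n + 1)
  let g : ℝ × (Fin n → ℝ) → ℝ := fun p => unitContribution q p.1 (∑ i, p.2 i) (∑ i, p.2 i ^ 2)
  have hg : Measurable g :=
    measurable_unitContribution q measurable_fst (by fun_prop) (by fun_prop)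
  have hmp := fun j : Fin (n + 1) =>
    measurePreserving_piFinSuccAbove (fun _ : Fin (n + 1) => paretoMeasure 1 μ) j
  have hge : ∀ (j : Fin (n + 1)) (s : Fin (n + 1) → ℝ),
      g (MeasurableEquiv.piFinSuccAbove (fun _ => ℝ) j s) = unitContribution q (s j)
        (∑ i, s (j.succAbove i)) (∑ i, s (j.succAbove i) ^ 2) := fun j s => rfl
  have hgi : ∀ j : Fin (n + 1), Integrable
      (fun s => g (MeasurableEquiv.piFinSuccAbove (fun _ => ℝ) j s)) (sizeLaw 1 μ (n + 1)) := by
    intro j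
    -- Each contribution is nonnegative, hence at most their sum, which is H^q ≤ 1.
    refine Integrable.of_bound
      (hg.comp (MeasurableEquiv.measurable _)).aestronglyMeasurable 1 ?_
    filter_upwards [ae_sizeLaw_le 1 μ one_pos hμ (n + 1)] with s hs
    have hn : ∀ j : Fin (n + 1), 0 ≤ unitContribution q (s j)
        (∑ i, s (j.succAbove i)) (∑ i, s (j.succAbove i) ^ 2) := fun j =>
      unitContribution_nonneg _ _ _ (Finset.sum_nonneg fun _ _ => sq_nonneg _)
    rw [hge, Real.norm_of_nonneg (hn j)]
    calc _ ≤ _ := Finset.single_le_sum (fun j _ => hn j) (Finset.mem_univ j)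
      _ = herfindahl s ^ q := (herfindahl_rpow_eq_sum_unitContribution q s hs).symm
      _ ≤ 1 := Real.rpow_le_one (herfindahl_nonneg s)
        (herfindahl_le_one s fun i => zero_le_one.trans (hs i)) hq.le
  have hgint : Integrable g ((paretoMeasure 1 μ).prod (sizeLaw 1 μ n)) :=
    ((hmp 0).integrable_comp_emb (MeasurableEquiv.measurableEmbedding _)).mp (hgi 0)
  have hterm : ∀ j : Fin (n + 1),
      ∫ s, g (MeasurableEquiv.piFinSuccAbove (fun _ => ℝ) j s) ∂(sizeLaw 1 μ (n + 1)) =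
      ∫ p, g p ∂((paretoMeasure 1 μ).prod (sizeLaw 1 μ n)) := fun j =>
    (hmp j).integral_comp' g
  have := isProbabilityMeasure_sizeLaw 1 μ one_pos hμ n
  have hsum : herfindahlMoment 1 μ q (n + 1) = ∑ j : Fin (n + 1),
      ∫ s, g (MeasurableEquiv.piFinSuccAbove (fun _ => ℝ) j s) ∂(sizeLaw 1 μ (n + 1)) := by
    rw [herfindahlMoment, ← integral_finsetSum _ fun j _ => hgi j]
    refine integral_congr_ae ?_
    filter_upwards [ae_sizeLaw_le 1 μ one_pos hμ (n + 1)] with s hs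
    simp only [hge]
    exact herfindahl_rpow_eq_sum_unitContribution q s hs
  rw [hsum, Finset.sum_congr rfl fun j _ => hterm j, Finset.sum_const, Finset.card_univ,
    Fintype.card_fin, nsmul_eq_mul, integral_prod_symm g hgint, integral_sizeLaw_eq_sequenceLaw μ hμ
      (hg.stronglyMeasurable.integral_prod_left').measurable]
  push_cast
  congr 2
  funext ω
  simp only [g, ← Fin.sum_univ_eq_sum_range (fun i => ω i),
    ← Fin.sum_univ_eq_sum_range (fun i => ω i ^ 2)]

/-- The leading coefficient of the `q`-th moment for `μ / 2 < q`. -/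
noncomputable def singleJumpCoeff (μ q : ℝ) : ℝ :=
  ∫ x in Set.Ioi 0, μ * x ^ (-(μ + 1)) * unitContribution q x (paretoMean μ) 0

/-- The threshold enters here: near 0 the integrand is of order x^(2r - μ - 1), integrable because r
> μ/2; at infinity x^(-μ-1) is integrable anyway. It is applied with r = min q 1, which exceeds μ/2
because μ < 2. -/
theorem integrableOn_unitContribution_bound {μ r c : ℝ} (hμ : 0 < μ) (hr : μ / 2 < r)
    (hc : 0 < c) :
    IntegrableOn (fun x : ℝ => μ * x ^ (-(μ + 1)) * ((x / (x + c)) ^ 2) ^ r) (Set.Ioi 0) := by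
  have hr0 : 0 < r := by linarith
  refine integrableOn_Ioi_zero_of_le_rpow (by fun_prop) (a := 2 * r - (μ + 1)) (b := -(μ + 1))
    (C := μ * (c ^ (2 * r))⁻¹) (D := μ) (by linarith) (by linarith) (fun x hx => by positivity)
    (fun x hx _ => ?_) (fun x hx => ?_)
  · have h1 : ((x / (x + c)) ^ 2) ^ r ≤ x ^ (2 * r) * (c ^ (2 * r))⁻¹ := by
      rw [← div_eq_mul_inv, ← Real.div_rpow hx.le hc.le, Real.rpow_mul (by positivity)]
      refine Real.rpow_le_rpow (by positivity) ?_ hr0.le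
      rw [Real.rpow_two]
      gcongr
      linarith
    rw [sub_eq_add_neg, Real.rpow_add hx]
    calc _ ≤ μ * x ^ (-(μ + 1)) * (x ^ (2 * r) * (c ^ (2 * r))⁻¹) := by gcongr
      _ = _ := by ring
  · have hx0 : 0 < x := by linarith
    refine mul_le_of_le_one_right (by positivity) (Real.rpow_le_one (by positivity) ?_ hr0.le)
    refine pow_le_one₀ (by positivity) ?_
    rw [div_le_one (by positivity)]
    linarith

theorem tendsto_unitContribution (q : ℝ) {x m : ℝ} (hx : 0 < x) (hm : 0 < m) {u v : ℕ → ℝ}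
    (hu : Tendsto u atTop (𝓝 m)) (hv : Tendsto v atTop (𝓝 0)) :
    Tendsto (fun n => unitContribution q x (u n) (v n)) atTop (𝓝 (unitContribution q x m 0)) := by
  unfold unitContribution
  have hxm : x + m ≠ 0 := by positivity
  have h1 := tendsto_const_nhds (x := x).add hu
  refine ((tendsto_const_nhds.div h1 hxm).pow 2).mul ?_
  refine ((tendsto_const_nhds.add hv).div (h1.pow 2) (pow_ne_zero 2 hxm)).rpow_const ?_
  left
  positivity

theorem unitContribution_zero_pos (q : ℝ) {x m : ℝ} (hx : 0 < x) (hm : 0 < m) :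
    0 < unitContribution q x m 0 := by
  unfold unitContribution
  positivity

theorem singleJumpCoeff_pos {μ q : ℝ} (hμ1 : 1 < μ) (hμ2 : μ < 2) (hq : μ / 2 < q) :
    0 < singleJumpCoeff μ q := by
  have hm : 0 < paretoMean μ := one_pos.trans_le (one_le_paretoMean μ hμ1)
  have hpos : ∀ x ∈ Set.Ioi (0 : ℝ),
      0 < μ * x ^ (-(μ + 1)) * unitContribution q x (paretoMean μ) 0 := fun x hx =>
    mul_pos (mul_pos (by linarith) (Real.rpow_pos_of_pos hx _))
      (unitContribution_zero_pos q hx hm)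
  have hmeas : Measurable fun x : ℝ =>
      μ * x ^ (-(μ + 1)) * unitContribution q x (paretoMean μ) 0 :=
    (by fun_prop : Measurable fun x : ℝ => μ * x ^ (-(μ + 1))).mul
      (measurable_unitContribution q measurable_id measurable_const measurable_const)
  have hint : IntegrableOn (fun x : ℝ =>
      μ * x ^ (-(μ + 1)) * unitContribution q x (paretoMean μ) 0) (Set.Ioi 0) := by
    refine (integrableOn_unitContribution_bound (μ := μ) (r := min q 1) (by linarith)
      (lt_min hq (by linarith)) hm).mono' hmeas.aestronglyMeasurable
      ((ae_restrict_iff' measurableSet_Ioi).mpr (ae_of_all _ fun x hx => ?_))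
    rw [Real.norm_of_nonneg (hpos x hx).le]
    have hx : 0 < x := hx
    have : 0 < μ := by linarith
    gcongr
    exact unitContribution_le (by linarith) hx hm le_rfl le_rfl (sq_nonneg _)
  rw [singleJumpCoeff, setIntegral_pos_iff_support_of_nonneg_ae
    ((ae_restrict_iff' measurableSet_Ioi).mpr (ae_of_all _ fun x hx => (hpos x hx).le)) hint]
  have : (Function.support fun x : ℝ =>
      μ * x ^ (-(μ + 1)) * unitContribution q x (paretoMean μ) 0) ∩ Set.Ioi 0 = Set.Ioi 0 :=
    Set.inter_eq_right.mpr fun x hx => (hpos x hx).ne'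
  rw [this, Real.volume_Ioi]
  exact ENNReal.zero_lt_top

/-- The density of the Pareto tail at `x`, in units of the number `n + 1` of sub-units, times the
contribution of a sub-unit of that size when the others have sum `u` and sum of squares `v`. -/
noncomputable def rescaledContribution (μ q : ℝ) (n : ℕ) (u v x : ℝ) : ℝ :=
  (Set.Ioi ((n : ℝ) + 1)⁻¹).indicator (fun x => μ * x ^ (-(μ + 1)) *
    unitContribution q x (u / (n + 1)) (v / ((n : ℝ) + 1) ^ 2)) x

/-- With K = n + 1, the K units and the tail factor K^(-μ) give K^(1-μ), which the normalisation
cancels; homogeneity of the contribution rescales u and v. -/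
theorem herfindahlMoment_succ_mul_rpow {μ q : ℝ} (hμ : 0 < μ) (hq : 0 < q) (n : ℕ) :
    herfindahlMoment 1 μ q (n + 1) * ((n : ℝ) + 1) ^ (μ - 1) =
      ∫ ω, (∫ x in Set.Ioi 0, rescaledContribution μ q n (∑ i ∈ Finset.range n, ω i)
        (∑ i ∈ Finset.range n, ω i ^ 2) x) ∂(sequenceLaw μ) := by
  have hn : (0 : ℝ) < n + 1 := by positivity
  rw [herfindahlMoment_succ μ q hμ hq]
  simp_rw [integral_paretoMeasure_one_eq_rescaled μ hμ _ hn, unitContribution_mul q _ _ _ hn]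
  rw [integral_const_mul, Real.rpow_sub_one hn.ne', Real.rpow_neg hn.le]
  have := (Real.rpow_pos_of_pos hn μ).ne'
  simp only [rescaledContribution]
  field_simp

theorem norm_rescaledContribution_le {μ q : ℝ} (hμ : 0 < μ) (hq : 0 < q) {n : ℕ} (hn : 1 ≤ n)
    {a : ℕ → ℝ} (ha : ∀ i, 1 ≤ a i) {x : ℝ} (hx : 0 < x) :
    ‖rescaledContribution μ q n (∑ i ∈ Finset.range n, a i) (∑ i ∈ Finset.range n, a i ^ 2) x‖ ≤
      μ * x ^ (-(μ + 1)) * ((x / (x + 1 / 2)) ^ 2) ^ (min q 1) := by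
  have hn1 : (1 : ℝ) ≤ n := Nat.one_le_cast.mpr hn
  have hsq : 0 ≤ ∑ i ∈ Finset.range n, a i ^ 2 := Finset.sum_nonneg fun _ _ => sq_nonneg _
  have hS : (n : ℝ) ≤ ∑ i ∈ Finset.range n, a i := by
    calc (n : ℝ) = ∑ i ∈ Finset.range n, (1 : ℝ) := by simp
      _ ≤ _ := Finset.sum_le_sum fun i _ => ha i
  refine (norm_indicator_le_norm_self _ _).trans ?_
  rw [Real.norm_of_nonneg (mul_nonneg (by positivity)
    (unitContribution_nonneg _ _ _ (by positivity)))]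
  gcongr
  refine unitContribution_le hq hx (by norm_num) ?_ (by positivity) ?_
  -- The constant 1/2 comes from n / (n + 1) ≥ 1/2 for n ≥ 1, the n sizes being at least 1.
  · rw [div_le_div_iff₀ (by norm_num) (by positivity)]
    linarith
  · rw [div_pow]
    gcongr
    exact sum_sq_le_sq_sum _ _ fun i _ => zero_le_one.trans (ha i)

theorem measurable_rescaledContribution {μ q : ℝ} {n : ℕ} {α : Type*} [MeasurableSpace α]
    {u v x : α → ℝ} (hu : Measurable u) (hv : Measurable v) (hx : Measurable x) :
    Measurable fun p => rescaledContribution μ q n (u p) (v p) (x p) := by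
  have h := (((hx.pow_const (-(μ + 1))).const_mul μ).mul
    (measurable_unitContribution q hx (hu.div_const ((n : ℝ) + 1))
      (hv.div_const (((n : ℝ) + 1) ^ 2)))).indicator
    (hx (measurableSet_Ioi (a := ((n : ℝ) + 1)⁻¹)))
  exact h

theorem tendsto_integral_rescaledContribution {μ q : ℝ} (hμ1 : 1 < μ) (hμ2 : μ < 2)
    (hq : μ / 2 < q) {a : ℕ → ℝ} (ha : ∀ i, 1 ≤ a i)
    (hlim : Tendsto (fun n : ℕ => (∑ i ∈ Finset.range n, a i) / (n : ℝ)) atTop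
      (𝓝 (paretoMean μ))) :
    Tendsto (fun n : ℕ => ∫ x in Set.Ioi 0, rescaledContribution μ q n
      (∑ i ∈ Finset.range n, a i) (∑ i ∈ Finset.range n, a i ^ 2) x) atTop
      (𝓝 (singleJumpCoeff μ q)) := by
  have hm : 0 < paretoMean μ := one_pos.trans_le (one_le_paretoMean μ hμ1)
  have hu : Tendsto (fun n : ℕ => (∑ i ∈ Finset.range n, a i) / ((n : ℝ) + 1)) atTop
      (𝓝 (paretoMean μ)) := by
    have := hlim.mul (tendsto_natCast_div_add_atTop (1 : ℝ))
    rw [mul_one] at this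
    refine this.congr' ?_
    filter_upwards [eventually_gt_atTop 0] with n hn
    have : (0 : ℝ) < n := Nat.cast_pos.mpr hn
    field_simp
  have hv := tendsto_sum_sq_div_sq_of_tendsto_average ha hlim
  refine tendsto_integral_filter_of_dominated_convergence
    (fun x : ℝ => μ * x ^ (-(μ + 1)) * ((x / (x + 1 / 2)) ^ 2) ^ (min q 1)) ?_ ?_
    (integrableOn_unitContribution_bound (by linarith) (lt_min hq (by linarith)) (by norm_num)) ?_
  · exact Eventually.of_forall fun n =>
      (measurable_rescaledContribution measurable_const measurable_const
        measurable_id).aestronglyMeasurable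
  · filter_upwards [eventually_ge_atTop 1] with n hn
    exact (ae_restrict_iff' measurableSet_Ioi).mpr (ae_of_all _ fun x hx =>
      norm_rescaledContribution_le (by linarith) (by linarith) hn ha hx)
  · refine (ae_restrict_iff' measurableSet_Ioi).mpr (ae_of_all _ fun x (hx : 0 < x) => ?_)
    refine ((tendsto_unitContribution q hx hm hu hv).const_mul _).congr' ?_
    -- For fixed x > 0 the cutoff 1 / (n + 1) is eventually below x.
    have hev := (tendsto_one_div_add_atTop_nhds_zero_nat (𝕜 := ℝ)).eventually (gt_mem_nhds hx)
    filter_upwards [hev] with n hn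
    rw [one_div] at hn
    rw [rescaledContribution, Set.indicator_of_mem (Set.mem_Ioi.mpr hn)]

/-- Dominated convergence is used twice: in x along each path obeying the law of large numbers, then
over paths, where the bound on the inner integral is a constant. -/
theorem tendsto_herfindahlMoment_mul_rpow_of_gt {μ q : ℝ} (hμ1 : 1 < μ) (hμ2 : μ < 2)
    (hq : μ / 2 < q) :
    Tendsto (fun K : ℕ => herfindahlMoment 1 μ q K * (K : ℝ) ^ (μ - 1)) atTop
      (𝓝 (singleJumpCoeff μ q)) := by
  have hμ0 : 0 < μ := by linarith
  have hq0 : 0 < q := by linarith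
  have := isProbabilityMeasure_sequenceLaw μ hμ0
  rw [← tendsto_add_atTop_iff_nat 1]
  push_cast
  simp_rw [herfindahlMoment_succ_mul_rpow hμ0 hq0]
  have hlim : singleJumpCoeff μ q = ∫ _, singleJumpCoeff μ q ∂(sequenceLaw μ) := by simp
  rw [hlim]
  refine tendsto_integral_filter_of_dominated_convergence (fun _ => ∫ x in Set.Ioi (0 : ℝ),
    μ * x ^ (-(μ + 1)) * ((x / (x + 1 / 2)) ^ 2) ^ (min q 1)) ?_ ?_ (integrable_const _) ?_
  · refine Eventually.of_forall fun n => ?_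
    have h : Measurable fun p : (ℕ → ℝ) × ℝ => rescaledContribution μ q n
        (∑ i ∈ Finset.range n, p.1 i) (∑ i ∈ Finset.range n, p.1 i ^ 2) p.2 :=
      measurable_rescaledContribution (by fun_prop) (by fun_prop) measurable_snd
    exact h.stronglyMeasurable.integral_prod_right.aestronglyMeasurable
  · filter_upwards [eventually_ge_atTop 1] with n hn
    filter_upwards [ae_sequenceLaw_one_le μ hμ0] with ω hω
    exact norm_integral_le_of_norm_le
      (integrableOn_unitContribution_bound hμ0 (lt_min hq (by linarith)) (by norm_num))
      ((ae_restrict_iff' measurableSet_Ioi).mpr (ae_of_all _ fun x hx =>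
        norm_rescaledContribution_le hμ0 hq0 hn hω hx))
  · filter_upwards [ae_sequenceLaw_one_le μ hμ0, ae_tendsto_average_sequenceLaw μ hμ1]
      with ω h1 h2
    exact tendsto_integral_rescaledContribution hμ1 hμ2 hq h1 h2

/-! ### The regime q < μ/2: moments of the sum of squares by Laplace transforms. -/

theorem setIntegral_Ioi_zero_pos {f : ℝ → ℝ} (hf : IntegrableOn f (Set.Ioi 0))
    (h : ∀ x, 0 < x → 0 < f x) : 0 < ∫ x in Set.Ioi 0, f x := by
  rw [setIntegral_pos_iff_support_of_nonneg_ae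
    ((ae_restrict_iff' measurableSet_Ioi).mpr (ae_of_all _ fun x hx => (h x hx).le)) hf]
  have : Function.support f ∩ Set.Ioi 0 = Set.Ioi 0 :=
    Set.inter_eq_right.mpr fun x hx => (h x hx).ne'
  rw [this, Real.volume_Ioi]
  exact ENNReal.zero_lt_top

theorem one_sub_exp_neg_nonneg {x : ℝ} (hx : 0 ≤ x) : 0 ≤ 1 - Real.exp (-x) :=
  sub_nonneg.mpr (Real.exp_le_one_iff.mpr (by linarith))

theorem one_sub_exp_neg_pos {x : ℝ} (hx : 0 < x) : 0 < 1 - Real.exp (-x) :=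
  sub_pos.mpr (Real.exp_lt_one_iff.mpr (by linarith))

theorem one_sub_exp_neg_le_one (x : ℝ) : 1 - Real.exp (-x) ≤ 1 := by
  linarith [Real.exp_pos (-x)]

theorem one_sub_exp_neg_le (x : ℝ) : 1 - Real.exp (-x) ≤ x := by
  linarith [Real.add_one_le_exp (-x)]

theorem integrableOn_one_sub_exp_mul_rpow {q : ℝ} (hq0 : 0 < q) (hq1 : q < 1) :
    IntegrableOn (fun t : ℝ => (1 - Real.exp (-t)) * t ^ (-(1 + q))) (Set.Ioi 0) := by
  refine integrableOn_Ioi_zero_of_le_rpow (by fun_prop) (a := -q) (b := -(1 + q)) (C := 1) (D := 1)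
    (by linarith) (by linarith)
    (fun x hx => mul_nonneg (one_sub_exp_neg_nonneg hx.le) (by positivity))
    (fun x hx _ => ?_) (fun x hx => ?_)
  · rw [one_mul]
    calc _ ≤ x * x ^ (-(1 + q)) := by
          gcongr
          exact one_sub_exp_neg_le x
      _ = _ := by
          rw [neg_add, Real.rpow_add hx, Real.rpow_neg_one, mul_inv_cancel_left₀ hx.ne']
  · have hx0 : 0 < x := by linarith
    gcongr
    exact one_sub_exp_neg_le_one x

/-- The constant relating `x ^ q` to its representation by means of `1 - exp (-t * x)`. -/
noncomputable def powerCoeff (q : ℝ) : ℝ :=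
  ∫ t in Set.Ioi 0, (1 - Real.exp (-t)) * t ^ (-(1 + q))

theorem powerCoeff_pos {q : ℝ} (hq0 : 0 < q) (hq1 : q < 1) : 0 < powerCoeff q :=
  setIntegral_Ioi_zero_pos (integrableOn_one_sub_exp_mul_rpow hq0 hq1) fun _ hx =>
    mul_pos (one_sub_exp_neg_pos hx) (Real.rpow_pos_of_pos hx _)

/-- Substitute t x for t. Fractional powers thus become mixtures of exponentials, whose expectations
factor over independent units. -/
theorem integral_one_sub_exp_mul_rpow {q x : ℝ} (hq0 : 0 < q) (hx : 0 ≤ x) :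
    ∫ t in Set.Ioi 0, (1 - Real.exp (-(t * x))) * t ^ (-(1 + q)) = powerCoeff q * x ^ q := by
  rcases hx.eq_or_lt with rfl | hx
  · simp [Real.zero_rpow hq0.ne']
  have h := integral_comp_mul_left_Ioi (fun t : ℝ => (1 - Real.exp (-t)) * t ^ (-(1 + q))) 0 hx
  rw [mul_zero, smul_eq_mul] at h
  have e : ∫ t in Set.Ioi 0, (1 - Real.exp (-(x * t))) * (x * t) ^ (-(1 + q)) =
      x ^ (-(1 + q)) * ∫ t in Set.Ioi 0, (1 - Real.exp (-(t * x))) * t ^ (-(1 + q)) := by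
    rw [← integral_const_mul]
    refine setIntegral_congr_fun measurableSet_Ioi fun t (ht : 0 < t) => ?_
    simp only [Real.mul_rpow hx.le ht.le]
    rw [mul_comm x t]
    ring
  rw [e] at h
  rw [powerCoeff]
  have e2 : x ^ (-(1 + q)) = x⁻¹ * (x ^ q)⁻¹ := by
    rw [neg_add, Real.rpow_add hx, Real.rpow_neg_one, Real.rpow_neg hx.le]
  have := (Real.rpow_pos_of_pos hx q).ne'
  rw [e2, mul_assoc] at h
  rw [mul_right_inj' (inv_ne_zero hx.ne'), inv_mul_eq_iff_eq_mul₀ this] at h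
  rw [h, mul_comm]

/-- This is the dominating function, used with α = μ/2: integrability at 0 is what requires q < μ/2.
-/
theorem integrableOn_min_one_mul_rpow {q α c : ℝ} (hq0 : 0 < q) (hq : q < α) (hc : 0 ≤ c) :
    IntegrableOn (fun t : ℝ => min 1 (c * t ^ α) * t ^ (-(1 + q))) (Set.Ioi 0) := by
  refine integrableOn_Ioi_zero_of_le_rpow (by fun_prop) (a := α - (1 + q)) (b := -(1 + q))
    (C := c) (D := 1) (by linarith) (by linarith) (fun x hx => by positivity)
    (fun x hx _ => ?_) (fun x hx => ?_)
  · rw [sub_eq_add_neg, Real.rpow_add hx, ← mul_assoc]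
    gcongr
    exact min_le_right _ _
  · have hx0 : 0 < x := by linarith
    gcongr
    exact min_le_left _ _

/-- One minus the Laplace transform of the law of the squared size. -/
noncomputable def laplaceDeficit (μ t : ℝ) : ℝ :=
  ∫ s, (1 - Real.exp (-(t * s ^ 2))) ∂(paretoMeasure 1 μ)

/-- The coefficient of `t ^ (μ / 2)` in `laplaceDeficit μ t` as `t` tends to zero. -/
noncomputable def tailCoeff (μ : ℝ) : ℝ :=
  ∫ x in Set.Ioi 0, μ * x ^ (-(μ + 1)) * (1 - Real.exp (-x ^ 2))

theorem integrableOn_tail {μ : ℝ} (hμ0 : 0 < μ) (hμ2 : μ < 2) :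
    IntegrableOn (fun x : ℝ => μ * x ^ (-(μ + 1)) * (1 - Real.exp (-x ^ 2))) (Set.Ioi 0) := by
  refine integrableOn_Ioi_zero_of_le_rpow (by fun_prop) (a := 2 - (μ + 1)) (b := -(μ + 1)) (C := μ)
    (D := μ) (by linarith) (by linarith)
    (fun x hx => mul_nonneg (by positivity) (one_sub_exp_neg_nonneg (sq_nonneg x)))
    (fun x hx _ => ?_) (fun x hx => ?_)
  · rw [sub_eq_add_neg 2, Real.rpow_add hx, Real.rpow_two]
    calc _ ≤ μ * x ^ (-(μ + 1)) * x ^ 2 := by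
          gcongr
          exact one_sub_exp_neg_le _
      _ = _ := by ring
  · have hx0 : 0 < x := by linarith
    exact mul_le_of_le_one_right (by positivity) (one_sub_exp_neg_le_one _)

theorem tailCoeff_pos {μ : ℝ} (hμ0 : 0 < μ) (hμ2 : μ < 2) : 0 < tailCoeff μ :=
  setIntegral_Ioi_zero_pos (integrableOn_tail hμ0 hμ2) fun x hx =>
    mul_pos (by positivity) (one_sub_exp_neg_pos (by positivity))

theorem laplaceDeficit_eq {μ t : ℝ} (hμ : 0 < μ) (ht : 0 < t) :
    laplaceDeficit μ t = t ^ (μ / 2) * ∫ x in Set.Ioi 0, (Set.Ioi √t).indicator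
      (fun x => μ * x ^ (-(μ + 1)) * (1 - Real.exp (-x ^ 2))) x := by
  have hs : 0 < √t := Real.sqrt_pos.mpr ht
  rw [laplaceDeficit, integral_paretoMeasure_one_eq_rescaled μ hμ _ (inv_pos.mpr hs), inv_inv]
  have e : (√t)⁻¹ ^ (-μ) = t ^ (μ / 2) := by
    rw [Real.inv_rpow hs.le, Real.rpow_neg hs.le, inv_inv, Real.sqrt_eq_rpow, ← Real.rpow_mul ht.le]
    congr 1
    ring
  have e2 : ∀ x : ℝ, t * ((√t)⁻¹ * x) ^ 2 = x ^ 2 := fun x => by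
    rw [mul_pow, inv_pow, Real.sq_sqrt ht.le, mul_inv_cancel_left₀ ht.ne']
  simp_rw [e, e2]

theorem laplaceDeficit_nonneg {μ t : ℝ} (ht : 0 ≤ t) : 0 ≤ laplaceDeficit μ t :=
  integral_nonneg fun s => one_sub_exp_neg_nonneg (by positivity)

theorem integrable_exp_neg_mul_sq_paretoMeasure {μ t : ℝ} (hμ : 0 < μ) (ht : 0 ≤ t) :
    Integrable (fun s : ℝ => Real.exp (-(t * s ^ 2))) (paretoMeasure 1 μ) := by
  have := isProbabilityMeasure_paretoMeasure one_pos hμ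
  refine Integrable.of_bound (by fun_prop) 1 (ae_of_all _ fun s => ?_)
  rw [Real.norm_of_nonneg (Real.exp_pos _).le]
  exact Real.exp_le_one_iff.mpr (neg_nonpos.mpr (by positivity))

theorem integral_exp_neg_mul_sq {μ t : ℝ} (hμ : 0 < μ) (ht : 0 ≤ t) :
    ∫ s, Real.exp (-(t * s ^ 2)) ∂(paretoMeasure 1 μ) = 1 - laplaceDeficit μ t := by
  have := isProbabilityMeasure_paretoMeasure one_pos hμ
  rw [laplaceDeficit, integral_sub (integrable_const _) (integrable_exp_neg_mul_sq_paretoMeasure hμ ht)]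
  simp

theorem laplaceDeficit_le_one {μ t : ℝ} (hμ : 0 < μ) (ht : 0 ≤ t) : laplaceDeficit μ t ≤ 1 := by
  have h : 0 ≤ ∫ s, Real.exp (-(t * s ^ 2)) ∂(paretoMeasure 1 μ) :=
    integral_nonneg fun s => (Real.exp_pos _).le
  rw [integral_exp_neg_mul_sq hμ ht] at h
  linarith

/-- Dropping the cutoff √t only enlarges the integral, so the small-t asymptotics is also a bound
for every t > 0. -/
theorem laplaceDeficit_le {μ t : ℝ} (hμ0 : 0 < μ) (hμ2 : μ < 2) (ht : 0 < t) :
    laplaceDeficit μ t ≤ tailCoeff μ * t ^ (μ / 2) := by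
  rw [laplaceDeficit_eq hμ0 ht, mul_comm]
  gcongr
  have hint := integrableOn_tail hμ0 hμ2
  refine setIntegral_mono_on (hint.indicator measurableSet_Ioi) hint measurableSet_Ioi
    fun x (hx : 0 < x) => ?_
  exact Set.indicator_le_self' (fun _ _ =>
    mul_nonneg (by positivity) (one_sub_exp_neg_nonneg (sq_nonneg x))) x

theorem tendsto_laplaceDeficit_div {μ : ℝ} (hμ0 : 0 < μ) (hμ2 : μ < 2) {t : ℕ → ℝ}
    (ht0 : ∀ᶠ n in atTop, 0 < t n) (ht : Tendsto t atTop (𝓝 0)) :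
    Tendsto (fun n => laplaceDeficit μ (t n) / t n ^ (μ / 2)) atTop (𝓝 (tailCoeff μ)) := by
  have h : Tendsto (fun n => ∫ x in Set.Ioi 0, (Set.Ioi √(t n)).indicator
      (fun x : ℝ => μ * x ^ (-(μ + 1)) * (1 - Real.exp (-x ^ 2))) x) atTop (𝓝 (tailCoeff μ)) := by
    refine tendsto_integral_of_dominated_convergence
      (fun x : ℝ => μ * x ^ (-(μ + 1)) * (1 - Real.exp (-x ^ 2))) (fun n => ?_)
      (integrableOn_tail hμ0 hμ2) (fun n => ?_) ?_
    · exact ((integrableOn_tail hμ0 hμ2).indicator measurableSet_Ioi).aestronglyMeasurable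
    · refine (ae_restrict_iff' measurableSet_Ioi).mpr (ae_of_all _ fun x (hx : 0 < x) => ?_)
      refine (norm_indicator_le_norm_self _ _).trans ?_
      rw [Real.norm_of_nonneg
        (mul_nonneg (by positivity) (one_sub_exp_neg_nonneg (sq_nonneg x)))]
    · refine (ae_restrict_iff' measurableSet_Ioi).mpr (ae_of_all _ fun x (hx : 0 < x) => ?_)
      have hs : Tendsto (fun n => √(t n)) atTop (𝓝 0) := by
        simpa [Function.comp_def] using (Real.continuous_sqrt.tendsto 0).comp ht
      refine tendsto_const_nhds.congr' ?_
      filter_upwards [hs.eventually (gt_mem_nhds hx)] with n hn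
      rw [Set.indicator_of_mem (Set.mem_Ioi.mpr hn)]
  refine h.congr' ?_
  filter_upwards [ht0] with n hn
  rw [laplaceDeficit_eq hμ0 hn, mul_div_cancel_left₀ _ (Real.rpow_pos_of_pos hn _).ne']

theorem integral_exp_neg_sum_sq {μ t : ℝ} (hμ : 0 < μ) (ht : 0 ≤ t) (K : ℕ) :
    ∫ s, Real.exp (-(t * ∑ i, s i ^ 2)) ∂(sizeLaw 1 μ K) = (1 - laplaceDeficit μ t) ^ K := by
  have := isProbabilityMeasure_paretoMeasure one_pos hμ
  have h := integral_fintype_prod_eq_pow (ι := Fin K) (μ := paretoMeasure 1 μ)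
    fun s : ℝ => Real.exp (-(t * s ^ 2))
  rw [integral_exp_neg_mul_sq hμ ht, Fintype.card_fin] at h
  rw [← h, sizeLaw]
  simp_rw [← Real.exp_sum, Finset.sum_neg_distrib, Finset.mul_sum]

theorem integral_one_sub_exp_neg_sum_sq {μ t : ℝ} (hμ : 0 < μ) (ht : 0 ≤ t) (K : ℕ) :
    ∫ s, (1 - Real.exp (-(t * ∑ i, s i ^ 2))) ∂(sizeLaw 1 μ K) =
      1 - (1 - laplaceDeficit μ t) ^ K := by
  have := isProbabilityMeasure_sizeLaw 1 μ one_pos hμ K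
  rw [integral_sub (integrable_const _), integral_exp_neg_sum_sq hμ ht]
  · simp
  · have hm : Measurable fun s : Fin K → ℝ => Real.exp (-(t * ∑ i, s i ^ 2)) := by fun_prop
    refine Integrable.of_bound hm.aestronglyMeasurable 1 (ae_of_all _ fun s => ?_)
    rw [Real.norm_of_nonneg (Real.exp_pos _).le]
    exact Real.exp_le_one_iff.mpr (neg_nonpos.mpr
      (mul_nonneg ht (Finset.sum_nonneg fun _ _ => sq_nonneg _)))

theorem one_sub_pow_laplaceDeficit_nonneg {μ t : ℝ} (hμ : 0 < μ) (ht : 0 ≤ t) (K : ℕ) :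
    0 ≤ 1 - (1 - laplaceDeficit μ t) ^ K := by
  have h0 := laplaceDeficit_nonneg (μ := μ) ht
  have h1 := laplaceDeficit_le_one hμ ht
  exact sub_nonneg.mpr (pow_le_one₀ (by linarith) (by linarith))

/-- Bernoulli's inequality gives the linear bound in K, which matches the scaling t ↦ t K^(-2/μ). -/
theorem one_sub_pow_laplaceDeficit_le {μ t : ℝ} (hμ0 : 0 < μ) (hμ2 : μ < 2) (ht : 0 < t) (K : ℕ) :
    1 - (1 - laplaceDeficit μ t) ^ K ≤ min 1 (K * tailCoeff μ * t ^ (μ / 2)) := by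
  have h1 := laplaceDeficit_le_one hμ0 ht.le
  refine le_min (sub_le_self _ (pow_nonneg (by linarith) K)) ?_
  have hb := one_add_mul_le_pow (a := -laplaceDeficit μ t) (by linarith) K
  rw [← sub_eq_add_neg] at hb
  have hl : (K : ℝ) * laplaceDeficit μ t ≤ K * (tailCoeff μ * t ^ (μ / 2)) := by
    gcongr
    exact laplaceDeficit_le hμ0 hμ2 ht
  linarith

theorem measurable_one_sub_pow_laplaceDeficit {μ : ℝ} (hμ : 0 < μ) (b : ℝ) (K : ℕ) :
    Measurable fun t : ℝ => 1 - (1 - laplaceDeficit μ (t * b)) ^ K := by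
  have := isProbabilityMeasure_paretoMeasure one_pos hμ
  have h : Measurable fun p : ℝ × ℝ => 1 - Real.exp (-(p.1 * b * p.2 ^ 2)) := by fun_prop
  have h2 : Measurable fun t => laplaceDeficit μ (t * b) :=
    h.stronglyMeasurable.integral_prod_right.measurable
  fun_prop

theorem integrable_laplace_representation {μ q b : ℝ} (hμ0 : 0 < μ) (hμ2 : μ < 2) (hq0 : 0 < q)
    (hq : q < μ / 2) (hb : 0 < b) (K : ℕ) :
    Integrable (fun p : ℝ × (Fin K → ℝ) =>
      (1 - Real.exp (-(p.1 * b * ∑ i, p.2 i ^ 2))) * p.1 ^ (-(1 + q)))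
      ((volume.restrict (Set.Ioi 0)).prod (sizeLaw 1 μ K)) := by
  have := isProbabilityMeasure_sizeLaw 1 μ one_pos hμ0 K
  have hmeas : Measurable fun p : ℝ × (Fin K → ℝ) =>
      (1 - Real.exp (-(p.1 * b * ∑ i, p.2 i ^ 2))) * p.1 ^ (-(1 + q)) := by fun_prop
  have hE : ∀ {t : ℝ}, 0 < t → ∀ s : Fin K → ℝ,
      0 ≤ 1 - Real.exp (-(t * b * ∑ i, s i ^ 2)) := fun ht s =>
    one_sub_exp_neg_nonneg (mul_nonneg (by positivity) (Finset.sum_nonneg fun _ _ => sq_nonneg _))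
  rw [integrable_prod_iff hmeas.aestronglyMeasurable]
  constructor
  · refine (ae_restrict_iff' measurableSet_Ioi).mpr (ae_of_all _ fun t (ht : 0 < t) => ?_)
    have hm : Measurable fun s : Fin K → ℝ => 1 - Real.exp (-(t * b * ∑ i, s i ^ 2)) := by
      fun_prop
    have hi : Integrable (fun s : Fin K → ℝ => 1 - Real.exp (-(t * b * ∑ i, s i ^ 2)))
        (sizeLaw 1 μ K) := by
      refine Integrable.of_bound hm.aestronglyMeasurable 1 (ae_of_all _ fun s => ?_)
      rw [Real.norm_of_nonneg (hE ht s)]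
      exact one_sub_exp_neg_le_one _
    exact hi.mul_const (t ^ (-(1 + q)))
  · have hc : 0 ≤ K * tailCoeff μ * b ^ (μ / 2) := by
      have := (tailCoeff_pos hμ0 hμ2).le
      positivity
    refine (integrableOn_min_one_mul_rpow hq0 hq hc).mono'
      hmeas.norm.stronglyMeasurable.integral_prod_right'.aestronglyMeasurable
      ((ae_restrict_iff' measurableSet_Ioi).mpr (ae_of_all _ fun t (ht : 0 < t) => ?_))
    rw [Real.norm_of_nonneg (integral_nonneg fun s => norm_nonneg _)]
    have htb : 0 < t * b := by positivity
    have e : ∀ s : Fin K → ℝ,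
        ‖(1 - Real.exp (-(t * b * ∑ i, s i ^ 2))) * t ^ (-(1 + q))‖ =
          (1 - Real.exp (-(t * b * ∑ i, s i ^ 2))) * t ^ (-(1 + q)) := fun s =>
      Real.norm_of_nonneg (mul_nonneg (hE ht s) (by positivity))
    simp_rw [e]
    rw [integral_mul_const, integral_one_sub_exp_neg_sum_sq hμ0 htb.le]
    gcongr
    refine (one_sub_pow_laplaceDeficit_le hμ0 hμ2 htb K).trans_eq ?_
    rw [Real.mul_rpow ht.le hb.le]
    ring_nf

theorem integral_laplace_representation {q b : ℝ} (hq0 : 0 < q) (hb : 0 < b) {K : ℕ}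
    (s : Fin K → ℝ) :
    ∫ t in Set.Ioi 0, (1 - Real.exp (-(t * b * ∑ i, s i ^ 2))) * t ^ (-(1 + q)) =
      powerCoeff q * (b * ∑ i, s i ^ 2) ^ q := by
  have := integral_one_sub_exp_mul_rpow hq0
    (mul_nonneg hb.le (Finset.sum_nonneg fun i (_ : i ∈ Finset.univ) => sq_nonneg (s i)))
  simpa only [mul_assoc] using this

/-- Integrability on the product space passes to the partial integral over t, which is the power up
to the positive factor `powerCoeff q`. -/
theorem integrable_sum_sq_rpow {μ q b : ℝ} (hμ0 : 0 < μ) (hμ2 : μ < 2) (hq0 : 0 < q)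
    (hq : q < μ / 2) (hb : 0 < b) (K : ℕ) :
    Integrable (fun s : Fin K → ℝ => (b * ∑ i, s i ^ 2) ^ q) (sizeLaw 1 μ K) := by
  have := isProbabilityMeasure_sizeLaw 1 μ one_pos hμ0 K
  have h := (integrable_laplace_representation hμ0 hμ2 hq0 hq hb K).integral_prod_right
  simp_rw [integral_laplace_representation hq0 hb] at h
  have h2 := h.const_mul (powerCoeff q)⁻¹
  simpa only [inv_mul_cancel_left₀ (powerCoeff_pos hq0 (by linarith)).ne'] using h2

theorem powerCoeff_mul_integral_sum_sq_rpow {μ q b : ℝ} (hμ0 : 0 < μ) (hμ2 : μ < 2) (hq0 : 0 < q)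
    (hq : q < μ / 2) (hb : 0 < b) (K : ℕ) :
    powerCoeff q * ∫ s, (b * ∑ i, s i ^ 2) ^ q ∂(sizeLaw 1 μ K) =
      ∫ t in Set.Ioi 0, (1 - (1 - laplaceDeficit μ (t * b)) ^ K) * t ^ (-(1 + q)) := by
  have := isProbabilityMeasure_sizeLaw 1 μ one_pos hμ0 K
  rw [← integral_const_mul]
  simp_rw [← integral_laplace_representation hq0 hb]
  rw [← integral_integral_swap (integrable_laplace_representation hμ0 hμ2 hq0 hq hb K)]
  refine setIntegral_congr_fun measurableSet_Ioi fun t (ht : 0 < t) => ?_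
  simp only [integral_mul_const]
  rw [integral_one_sub_exp_neg_sum_sq hμ0 (by positivity)]

/-- The `q`-th moment of the limit in law of the normalised sum of squared sizes. -/
noncomputable def stableMoment (μ q : ℝ) : ℝ :=
  (powerCoeff q)⁻¹ *
    ∫ t in Set.Ioi 0, (1 - Real.exp (-(tailCoeff μ * t ^ (μ / 2)))) * t ^ (-(1 + q))

theorem stableMoment_pos {μ q : ℝ} (hμ0 : 0 < μ) (hμ2 : μ < 2) (hq0 : 0 < q) (hq : q < μ / 2) :
    0 < stableMoment μ q := by
  have hc := tailCoeff_pos hμ0 hμ2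
  refine mul_pos (inv_pos.mpr (powerCoeff_pos hq0 (by linarith)))
    (setIntegral_Ioi_zero_pos ?_ fun x hx =>
      mul_pos (one_sub_exp_neg_pos (by positivity)) (by positivity))
  refine (integrableOn_min_one_mul_rpow hq0 hq hc.le).mono'
    (by fun_prop) ((ae_restrict_iff' measurableSet_Ioi).mpr (ae_of_all _ fun x (hx : 0 < x) => ?_))
  rw [Real.norm_of_nonneg (mul_nonneg (one_sub_exp_neg_nonneg (by positivity)) (by positivity))]
  gcongr
  exact le_min (one_sub_exp_neg_le_one _) (one_sub_exp_neg_le _)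

/-- At t K^(-2/μ) the deficit is asymptotically `tailCoeff μ` · t^(μ/2) / K, so its complement to
the power K tends to the Laplace transform of a stable law of index μ/2. The bound on the integrand
is uniform in K, so the moments converge directly, without a limit theorem in law. -/
theorem tendsto_integral_sum_sq_rpow {μ q : ℝ} (hμ0 : 0 < μ) (hμ2 : μ < 2) (hq0 : 0 < q)
    (hq : q < μ / 2) :
    Tendsto (fun K : ℕ => ∫ s, ((K : ℝ) ^ (-(2 / μ)) * ∑ i, s i ^ 2) ^ q ∂(sizeLaw 1 μ K)) atTop
      (𝓝 (stableMoment μ q)) := by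
  have hcoeff := powerCoeff_pos hq0 (by linarith : q < 1)
  have hc := tailCoeff_pos hμ0 hμ2
  have hpow : ∀ K : ℕ, 0 < K → ∀ t : ℝ, 0 < t →
      (t * (K : ℝ) ^ (-(2 / μ))) ^ (μ / 2) = t ^ (μ / 2) / K := fun K hK t ht => by
    have hK' : (0 : ℝ) < K := Nat.cast_pos.mpr hK
    rw [Real.mul_rpow ht.le (by positivity), ← Real.rpow_mul hK'.le,
      show -(2 / μ) * (μ / 2) = -1 by field_simp, Real.rpow_neg_one, ← div_eq_mul_inv]
  have hmain : Tendsto (fun K : ℕ => ∫ t in Set.Ioi 0,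
      (1 - (1 - laplaceDeficit μ (t * (K : ℝ) ^ (-(2 / μ)))) ^ K) * t ^ (-(1 + q))) atTop
      (𝓝 (∫ t in Set.Ioi 0,
        (1 - Real.exp (-(tailCoeff μ * t ^ (μ / 2)))) * t ^ (-(1 + q)))) := by
    refine tendsto_integral_filter_of_dominated_convergence
      (fun t : ℝ => min 1 (tailCoeff μ * t ^ (μ / 2)) * t ^ (-(1 + q))) ?_ ?_
      (integrableOn_min_one_mul_rpow hq0 hq hc.le) ?_
    · exact Eventually.of_forall fun K => ((measurable_one_sub_pow_laplaceDeficit hμ0 _ K).mul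
        (by fun_prop)).aestronglyMeasurable
    · filter_upwards [eventually_gt_atTop 0] with K hK
      refine (ae_restrict_iff' measurableSet_Ioi).mpr (ae_of_all _ fun t (ht : 0 < t) => ?_)
      have hK' : (0 : ℝ) < K := Nat.cast_pos.mpr hK
      rw [Real.norm_of_nonneg (mul_nonneg
        (one_sub_pow_laplaceDeficit_nonneg hμ0 (by positivity) K) (by positivity))]
      gcongr
      refine (one_sub_pow_laplaceDeficit_le hμ0 hμ2 (by positivity) K).trans_eq ?_
      rw [hpow K hK t ht]
      field_simp
    · refine (ae_restrict_iff' measurableSet_Ioi).mpr (ae_of_all _ fun t (ht : 0 < t) => ?_)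
      refine Tendsto.mul_const _ (tendsto_const_nhds.sub ?_)
      have ht0 : Tendsto (fun K : ℕ => t * (K : ℝ) ^ (-(2 / μ))) atTop (𝓝 0) := by
        have := ((tendsto_rpow_neg_atTop (by positivity : 0 < 2 / μ)).comp
          tendsto_natCast_atTop_atTop).const_mul t
        simpa using this
      have hpos : ∀ᶠ K : ℕ in atTop, 0 < t * (K : ℝ) ^ (-(2 / μ)) := by
        filter_upwards [eventually_gt_atTop 0] with K hK
        have hK' : (0 : ℝ) < K := Nat.cast_pos.mpr hK
        positivity
      have h1 := (tendsto_laplaceDeficit_div hμ0 hμ2 hpos ht0).mul_const (t ^ (μ / 2))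
      have h2 : Tendsto (fun K : ℕ => (K : ℝ) * -laplaceDeficit μ (t * (K : ℝ) ^ (-(2 / μ))))
          atTop (𝓝 (-(tailCoeff μ * t ^ (μ / 2)))) := by
        refine h1.neg.congr' ?_
        filter_upwards [eventually_gt_atTop 0] with K hK
        have hK' : (0 : ℝ) < K := Nat.cast_pos.mpr hK
        have := (Real.rpow_pos_of_pos ht (μ / 2)).ne'
        rw [hpow K hK t ht]
        field_simp
      simpa only [← sub_eq_add_neg] using Real.tendsto_one_add_pow_exp_of_tendsto h2
  refine (hmain.const_mul (powerCoeff q)⁻¹).congr' ?_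
  filter_upwards [eventually_gt_atTop 0] with K hK
  have hK' : (0 : ℝ) < K := Nat.cast_pos.mpr hK
  rw [← powerCoeff_mul_integral_sum_sq_rpow hμ0 hμ2 hq0 hq (by positivity),
    inv_mul_cancel_left₀ hcoeff.ne']

/-! ### Replacing the denominator by its almost sure limit. -/

theorem mul_le_mul_add_rpow_mul_rpow {a d M p : ℝ} (ha : 0 ≤ a) (hd0 : 0 ≤ d) (hd1 : d ≤ 1)
    (hM : 0 < M) (hp : 1 < p) : a * d ≤ M * d + M ^ (-(p - 1)) * a ^ p := by
  rcases le_or_gt a M with h | h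
  · have h2 : 0 ≤ M ^ (-(p - 1)) * a ^ p := by positivity
    nlinarith [mul_le_mul_of_nonneg_right h hd0]
  · have ha0 : 0 < a := hM.trans h
    have h1 : a ^ (-(p - 1)) ≤ M ^ (-(p - 1)) :=
      Real.rpow_le_rpow_of_nonpos hM h.le (by linarith)
    calc a * d ≤ a := mul_le_of_le_one_right ha hd1
      _ = a ^ (-(p - 1)) * a ^ p := by
        rw [← Real.rpow_add ha0]; ring_nf; rw [Real.rpow_one]
      _ ≤ M ^ (-(p - 1)) * a ^ p := by gcongr
      _ ≤ _ := le_add_of_nonneg_left (by positivity)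

/-- A bound in L^p with p > 1 makes A uniformly integrable: truncating A at M leaves M E|D|, which
vanishes, and an error at most M^(1-p) C uniformly in large n. -/
theorem tendsto_integral_mul_zero_of_rpow_bounded {Ω : Type*} [MeasurableSpace Ω] {P : Measure Ω}
    [IsFiniteMeasure P] {A D : ℕ → Ω → ℝ} {p C : ℝ} (hp : 1 < p) (hA0 : ∀ n ω, 0 ≤ A n ω)
    (hAp : ∀ᶠ n in atTop, Integrable (fun ω => A n ω ^ p) P)
    (hC : ∀ᶠ n in atTop, ∫ ω, A n ω ^ p ∂P ≤ C) (hDm : ∀ n, Measurable (D n))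
    (hD1 : ∀ᶠ n in atTop, ∀ᵐ ω ∂P, |D n ω| ≤ 1)
    (hD : ∀ᵐ ω ∂P, Tendsto (fun n => D n ω) atTop (𝓝 0)) :
    Tendsto (fun n => ∫ ω, A n ω * D n ω ∂P) atTop (𝓝 0) := by
  have hDint : Tendsto (fun n => ∫ ω, |D n ω| ∂P) atTop (𝓝 0) := by
    have h := tendsto_integral_filter_of_dominated_convergence (μ := P) (l := atTop)
      (F := fun n ω => |D n ω|) (f := fun _ => (0 : ℝ)) (fun _ => (1 : ℝ))
      (Eventually.of_forall fun n => (hDm n).abs.aestronglyMeasurable)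
      (by simpa using hD1) (integrable_const _)
      (by filter_upwards [hD] with ω h; simpa using h.abs)
    simpa using h
  rw [Metric.tendsto_atTop']
  intro ε hε
  obtain ⟨M, hM0, hM⟩ : ∃ M : ℝ, 0 < M ∧ M ^ (-(p - 1)) * C < ε / 2 := by
    have h := (tendsto_rpow_neg_atTop (by linarith : 0 < p - 1)).mul_const C
    rw [zero_mul] at h
    obtain ⟨M, h1, h2⟩ := ((h.eventually (gt_mem_nhds (half_pos hε))).and
      (eventually_gt_atTop 0)).exists
    exact ⟨M, h2, h1⟩
  have hev : ∀ᶠ n in atTop, M * ∫ ω, |D n ω| ∂P < ε / 2 := by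
    have h := hDint.const_mul M
    rw [mul_zero] at h
    exact h.eventually (gt_mem_nhds (half_pos hε))
  have hall : ∀ᶠ n in atTop, dist (∫ ω, A n ω * D n ω ∂P) 0 < ε := by
    filter_upwards [hAp, hC, hD1, hev] with n h1 h2 h3 h4
    have hDi : Integrable (fun ω => |D n ω|) P :=
      Integrable.of_bound (hDm n).abs.aestronglyMeasurable 1 (by simpa using h3)
    rw [dist_zero_right]
    calc ‖∫ ω, A n ω * D n ω ∂P‖
        ≤ ∫ ω, (M * |D n ω| + M ^ (-(p - 1)) * A n ω ^ p) ∂P := by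
          refine norm_integral_le_of_norm_le ((hDi.const_mul _).add (h1.const_mul _)) ?_
          filter_upwards [h3] with ω hω
          rw [norm_mul, Real.norm_of_nonneg (hA0 n ω), Real.norm_eq_abs]
          exact mul_le_mul_add_rpow_mul_rpow (hA0 n ω) (abs_nonneg _) hω hM0 hp
      _ = M * ∫ ω, |D n ω| ∂P + M ^ (-(p - 1)) * ∫ ω, A n ω ^ p ∂P := by
          rw [integral_add (hDi.const_mul _) (h1.const_mul _), integral_const_mul,
            integral_const_mul]
      _ ≤ M * ∫ ω, |D n ω| ∂P + M ^ (-(p - 1)) * C := by gcongr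
      _ < ε := by linarith
  obtain ⟨N, hN⟩ := eventually_atTop.mp hall
  exact ⟨N, fun n hn => hN n hn.le⟩

/-- The `q`-th power of the sum of the first `K` squared sizes, normalised to converge in law. -/
noncomputable def normalizedSumSq (μ q : ℝ) (K : ℕ) (ω : ℕ → ℝ) : ℝ :=
  ((K : ℝ) ^ (-(2 / μ)) * ∑ i ∈ Finset.range K, ω i ^ 2) ^ q

theorem normalizedSumSq_nonneg (μ q : ℝ) (K : ℕ) (ω : ℕ → ℝ) : 0 ≤ normalizedSumSq μ q K ω :=
  Real.rpow_nonneg (mul_nonneg (by positivity) (Finset.sum_nonneg fun _ _ => sq_nonneg _)) q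

theorem normalizedSumSq_rpow (μ q p : ℝ) (K : ℕ) (ω : ℕ → ℝ) :
    normalizedSumSq μ q K ω ^ p = normalizedSumSq μ (q * p) K ω :=
  (Real.rpow_mul
    (mul_nonneg (by positivity) (Finset.sum_nonneg fun _ _ => sq_nonneg _)) q p).symm

theorem normalizedSumSq_eq (μ q : ℝ) (K : ℕ) (ω : ℕ → ℝ) :
    normalizedSumSq μ q K ω = ((K : ℝ) ^ (-(2 / μ)) * ∑ i : Fin K, ω i ^ 2) ^ q := by
  rw [normalizedSumSq, Fin.sum_univ_eq_sum_range fun i => ω i ^ 2]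

theorem integrable_normalizedSumSq {μ q : ℝ} (hμ0 : 0 < μ) (hμ2 : μ < 2) (hq0 : 0 < q)
    (hq : q < μ / 2) {K : ℕ} (hK : 0 < K) :
    Integrable (normalizedSumSq μ q K) (sequenceLaw μ) := by
  have hK' : (0 : ℝ) < K := Nat.cast_pos.mpr hK
  have h := (measurePreserving_sequenceLaw_sizeLaw μ hμ0 K).integrable_comp_of_integrable
    (integrable_sum_sq_rpow hμ0 hμ2 hq0 hq (by positivity : 0 < (K : ℝ) ^ (-(2 / μ))) K)
  exact h.congr (ae_of_all _ fun ω => (normalizedSumSq_eq μ q K ω).symm)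

theorem tendsto_integral_normalizedSumSq {μ q : ℝ} (hμ0 : 0 < μ) (hμ2 : μ < 2) (hq0 : 0 < q)
    (hq : q < μ / 2) :
    Tendsto (fun K : ℕ => ∫ ω, normalizedSumSq μ q K ω ∂(sequenceLaw μ)) atTop
      (𝓝 (stableMoment μ q)) := by
  refine (tendsto_integral_sum_sq_rpow hμ0 hμ2 hq0 hq).congr fun K => ?_
  rw [integral_sizeLaw_eq_sequenceLaw μ hμ0
    (g := fun s : Fin K → ℝ => ((K : ℝ) ^ (-(2 / μ)) * ∑ i, s i ^ 2) ^ q) (by fun_prop)]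
  simp_rw [normalizedSumSq_eq]

/-- The exponent splits as -2q/μ + 2q: the first part normalises Q^q, the second turns S into the
average S/K. -/
theorem herfindahl_rpow_mul_rpow (μ q : ℝ) (hμ : 0 < μ) {K : ℕ} (hK : 0 < K) {ω : ℕ → ℝ}
    (hω : ∀ i, 1 ≤ ω i) :
    herfindahl (fun i : Fin K => ω i) ^ q * (K : ℝ) ^ (2 * q * (μ - 1) / μ) =
      normalizedSumSq μ q K ω * ((∑ i ∈ Finset.range K, ω i) / K) ^ (-(2 * q)) := by
  have hK' : (0 : ℝ) < K := Nat.cast_pos.mpr hK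
  have hS : 0 < ∑ i ∈ Finset.range K, ω i :=
    Finset.sum_pos (fun i _ => one_pos.trans_le (hω i)) ⟨0, Finset.mem_range.mpr hK⟩
  have hN : 0 ≤ ∑ i ∈ Finset.range K, ω i ^ 2 := Finset.sum_nonneg fun _ _ => sq_nonneg _
  have hexp : 2 * q * (μ - 1) / μ = -(2 / μ) * q + 2 * q := by field_simp; ring
  rw [herfindahl, Fin.sum_univ_eq_sum_range fun i => ω i ^ 2, Fin.sum_univ_eq_sum_range fun i => ω i,
    normalizedSumSq, Real.div_rpow hN (by positivity), Real.mul_rpow (by positivity) hN,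
    Real.div_rpow hS.le hK'.le, hexp, Real.rpow_add hK', Real.rpow_neg hS.le,
    Real.rpow_neg hK'.le (2 * q), Real.rpow_mul hK'.le, ← Real.rpow_natCast, ← Real.rpow_mul hS.le]
  push_cast
  have h1 := (Real.rpow_pos_of_pos hS (2 * q)).ne'
  have h2 := (Real.rpow_pos_of_pos hK' (2 * q)).ne'
  generalize ((K : ℝ) ^ (-(2 / μ))) ^ q = c
  field_simp

theorem one_le_average {K : ℕ} (hK : 0 < K) {ω : ℕ → ℝ} (hω : ∀ i, 1 ≤ ω i) :
    1 ≤ (∑ i ∈ Finset.range K, ω i) / (K : ℝ) := by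
  rw [one_le_div (Nat.cast_pos.mpr hK)]
  calc (K : ℝ) = ∑ i ∈ Finset.range K, (1 : ℝ) := by simp
    _ ≤ _ := Finset.sum_le_sum fun i _ => hω i

/-- The leading coefficient of the `q`-th moment for `q < μ / 2`. -/
noncomputable def stableCoeff (μ q : ℝ) : ℝ := stableMoment μ q * paretoMean μ ^ (-(2 * q))

theorem stableCoeff_pos {μ q : ℝ} (hμ1 : 1 < μ) (hμ2 : μ < 2) (hq0 : 0 < q) (hq : q < μ / 2) :
    0 < stableCoeff μ q :=
  mul_pos (stableMoment_pos (by linarith) hμ2 hq0 hq)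
    (Real.rpow_pos_of_pos (one_pos.trans_le (one_le_paretoMean μ hμ1)) _)

theorem tendsto_herfindahlMoment_mul_rpow_of_lt {μ q : ℝ} (hμ1 : 1 < μ) (hμ2 : μ < 2)
    (hq0 : 0 < q) (hq : q < μ / 2) :
    Tendsto (fun K : ℕ => herfindahlMoment 1 μ q K * (K : ℝ) ^ (2 * q * (μ - 1) / μ)) atTop
      (𝓝 (stableCoeff μ q)) := by
  have hμ0 : 0 < μ := by linarith
  have hm1 := one_le_paretoMean μ hμ1
  have hm0 : 0 < paretoMean μ := one_pos.trans_le hm1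
  have := isProbabilityMeasure_sequenceLaw μ hμ0
  -- Room below μ/2 provides the higher moment: the power r/q > 1 of the numerator has a convergent,
  -- hence bounded, mean.
  obtain ⟨r, hqr, hr⟩ := exists_between hq
  have hp : 1 < r / q := (one_lt_div hq0).mpr hqr
  have hqp : q * (r / q) = r := mul_div_cancel₀ _ hq0.ne'
  let D : ℕ → (ℕ → ℝ) → ℝ := fun K ω =>
    ((∑ i ∈ Finset.range K, ω i) / (K : ℝ)) ^ (-(2 * q)) - paretoMean μ ^ (-(2 * q))
  have hDm : ∀ K, Measurable (D K) := fun K => by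
    have : Measurable fun ω : ℕ → ℝ => (∑ i ∈ Finset.range K, ω i) / (K : ℝ) := by fun_prop
    exact (this.pow_const _).sub_const _
  -- The average and its limit are at least 1, so both negative powers lie in [0, 1].
  have hD1 : ∀ᶠ K in atTop, ∀ᵐ ω ∂(sequenceLaw μ), |D K ω| ≤ 1 := by
    filter_upwards [eventually_gt_atTop 0] with K hK
    filter_upwards [ae_sequenceLaw_one_le μ hμ0] with ω hω
    have h1 := one_le_average hK hω
    have h2 := Real.rpow_le_one_of_one_le_of_nonpos h1 (by linarith : -(2 * q) ≤ 0)
    have h3 := Real.rpow_le_one_of_one_le_of_nonpos hm1 (by linarith : -(2 * q) ≤ 0)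
    have h4 := Real.rpow_nonneg (zero_le_one.trans h1) (-(2 * q))
    have h5 := Real.rpow_nonneg hm0.le (-(2 * q))
    simp only [D]
    rw [abs_le]
    constructor <;> linarith
  have hD : ∀ᵐ ω ∂(sequenceLaw μ), Tendsto (fun K => D K ω) atTop (𝓝 0) := by
    filter_upwards [ae_tendsto_average_sequenceLaw μ hμ1] with ω hω
    have h := (hω.rpow_const (p := -(2 * q)) (Or.inl hm0.ne')).sub_const
      (paretoMean μ ^ (-(2 * q)))
    rwa [sub_self] at h
  have hr0 : 0 < r := hq0.trans hqr
  have herr := tendsto_integral_mul_zero_of_rpow_bounded (P := sequenceLaw μ)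
    (A := normalizedSumSq μ q) (D := D) (C := stableMoment μ r + 1) hp
    (normalizedSumSq_nonneg μ q)
    (by
      filter_upwards [eventually_gt_atTop 0] with K hK
      simp_rw [normalizedSumSq_rpow, hqp]
      exact integrable_normalizedSumSq hμ0 hμ2 hr0 hr hK)
    (by
      simp_rw [normalizedSumSq_rpow, hqp]
      filter_upwards [(tendsto_integral_normalizedSumSq hμ0 hμ2 hr0 hr).eventually
        (gt_mem_nhds (lt_add_one _))] with K hK using hK.le)
    hDm hD1 hD
  have hmain := (tendsto_integral_normalizedSumSq hμ0 hμ2 hq0 hq).mul_const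
    (paretoMean μ ^ (-(2 * q)))
  have hsum := hmain.add herr
  rw [add_zero] at hsum
  refine hsum.congr' ?_
  filter_upwards [eventually_gt_atTop 0, hD1] with K hK hDK
  have hA := integrable_normalizedSumSq hμ0 hμ2 hq0 hq hK
  have hAD : Integrable (fun ω => normalizedSumSq μ q K ω * D K ω) (sequenceLaw μ) :=
    hA.mul_bdd (hDm K).aestronglyMeasurable (by simpa using hDK)
  rw [← integral_mul_const, ← integral_add (hA.mul_const _) hAD, herfindahlMoment,
    integral_sizeLaw_eq_sequenceLaw μ hμ0 ((measurable_herfindahl _).pow_const q),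
    ← integral_mul_const]
  refine integral_congr_ae ?_
  filter_upwards [ae_sequenceLaw_one_le μ hμ0] with ω hω
  rw [herfindahl_rpow_mul_rpow μ q hμ0 hK hω]
  simp only [D]
  ring

/-! ### Comparison of the two exponents and asymptotic equivalents. -/

theorem isLittleO_natCast_rpow_rpow {a b : ℝ} (h : a < b) :
    (fun K : ℕ => (K : ℝ) ^ a) =o[atTop] fun K : ℕ => (K : ℝ) ^ b := by
  have ht : Tendsto (fun K : ℕ => (K : ℝ) ^ (-(b - a))) atTop (𝓝 0) :=
    (tendsto_rpow_neg_atTop (sub_pos.mpr h)).comp tendsto_natCast_atTop_atTop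
  have hb : ∀ᶠ K : ℕ in atTop, (K : ℝ) ^ b = 0 → (K : ℝ) ^ a = 0 := by
    filter_upwards [eventually_gt_atTop 0] with K hK h0
    exact absurd h0 (Real.rpow_pos_of_pos (Nat.cast_pos.mpr hK) b).ne'
  rw [Asymptotics.isLittleO_iff_tendsto' hb]
  refine ht.congr' ?_
  filter_upwards [eventually_gt_atTop 0] with K hK
  rw [neg_sub, Real.rpow_sub (Nat.cast_pos.mpr hK)]

theorem isEquivalent_const_mul_rpow_of_tendsto {f : ℕ → ℝ} {C a b : ℝ} (hC : C ≠ 0) (hab : a = -b)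
    (h : Tendsto (fun K => f K * (K : ℝ) ^ a) atTop (𝓝 C)) :
    Asymptotics.IsEquivalent atTop f fun K : ℕ => C * (K : ℝ) ^ b := by
  subst hab
  refine (Asymptotics.isEquivalent_iff_tendsto_one ?_).mpr ?_
  · filter_upwards [eventually_gt_atTop 0] with K hK
    exact mul_ne_zero hC (Real.rpow_pos_of_pos (Nat.cast_pos.mpr hK) b).ne'
  · have h2 := h.div_const C
    rw [div_self hC] at h2
    refine h2.congr' ?_
    filter_upwards [eventually_gt_atTop 0] with K hK
    rw [Pi.div_apply, Real.rpow_neg K.cast_nonneg]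
    field_simp

theorem isEquivalent_herfindahlMoment_of_gt {μ q s₀ : ℝ} (hμ1 : 1 < μ) (hμ2 : μ < 2)
    (hq : μ / 2 < q) (hs : 0 < s₀) :
    Asymptotics.IsEquivalent atTop (fun K : ℕ => herfindahlMoment s₀ μ q K)
      fun K : ℕ => singleJumpCoeff μ q * (K : ℝ) ^ (1 - μ) := by
  simp_rw [herfindahlMoment_eq_scale_one s₀ μ q hs (by linarith)]
  exact isEquivalent_const_mul_rpow_of_tendsto (singleJumpCoeff_pos hμ1 hμ2 hq).ne'
    (neg_sub 1 μ).symm (tendsto_herfindahlMoment_mul_rpow_of_gt hμ1 hμ2 hq)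

theorem isEquivalent_herfindahlMoment_of_lt {μ q s₀ : ℝ} (hμ1 : 1 < μ) (hμ2 : μ < 2)
    (hq0 : 0 < q) (hq : q < μ / 2) (hs : 0 < s₀) :
    Asymptotics.IsEquivalent atTop (fun K : ℕ => herfindahlMoment s₀ μ q K)
      fun K : ℕ => stableCoeff μ q * (K : ℝ) ^ (2 * q * (1 - μ) / μ) := by
  simp_rw [herfindahlMoment_eq_scale_one s₀ μ q hs (by linarith)]
  exact isEquivalent_const_mul_rpow_of_tendsto (stableCoeff_pos hμ1 hμ2 hq0 hq).ne'
    (by ring) (tendsto_herfindahlMoment_mul_rpow_of_lt hμ1 hμ2 hq0 hq)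

theorem rpow_exponent_lt_iff {μ q : ℝ} (hμ1 : 1 < μ) :
    2 * q * (1 - μ) / μ < 1 - μ ↔ μ / 2 < q := by
  rw [div_lt_iff₀ (by linarith), div_lt_iff₀ two_pos]
  constructor <;> intro h <;> nlinarith

theorem lt_rpow_exponent_iff {μ q : ℝ} (hμ1 : 1 < μ) :
    1 - μ < 2 * q * (1 - μ) / μ ↔ q < μ / 2 := by
  rw [lt_div_iff₀ (by linarith), lt_div_iff₀ two_pos]
  constructor <;> intro h <;> nlinarith

end Herfindahl

theorem proposition2 (μ : ℝ) (hμ1 : 1 < μ) (hμ2 : μ < 2) :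
    -- all the moments are finite
    (∀ q : ℝ, 0 < q → ∀ s₀ : ℝ, 0 < s₀ → ∀ K : ℕ,
      Integrable (fun s : Fin K → ℝ => herfindahl s ^ q) (sizeLaw s₀ μ K)) ∧
    -- the two-term leading-order asymptotics, and which of the two terms dominates
    (∀ q : ℝ, 0 < q → q ≠ μ / 2 → ∃ C₁ C₂ : ℝ,
      (∀ s₀ : ℝ, 0 < s₀ →
        (fun K : ℕ => herfindahlMoment s₀ μ q K -
            (C₁ * (K : ℝ) ^ (1 - μ) + C₂ * (K : ℝ) ^ (2 * q * (1 - μ) / μ)))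
          =o[atTop] fun K : ℕ => (K : ℝ) ^ (max (1 - μ) (2 * q * (1 - μ) / μ))) ∧
      (μ / 2 < q → 0 < C₁ ∧
        ((fun K : ℕ => (K : ℝ) ^ (2 * q * (1 - μ) / μ))
          =o[atTop] fun K : ℕ => (K : ℝ) ^ (1 - μ)) ∧
        ∀ s₀ : ℝ, 0 < s₀ →
          Asymptotics.IsEquivalent atTop (fun K : ℕ => herfindahlMoment s₀ μ q K)
            (fun K : ℕ => C₁ * (K : ℝ) ^ (1 - μ))) ∧
      (q < μ / 2 → 0 < C₂ ∧
        ((fun K : ℕ => (K : ℝ) ^ (1 - μ))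
          =o[atTop] fun K : ℕ => (K : ℝ) ^ (2 * q * (1 - μ) / μ)) ∧
        ∀ s₀ : ℝ, 0 < s₀ →
          Asymptotics.IsEquivalent atTop (fun K : ℕ => herfindahlMoment s₀ μ q K)
            (fun K : ℕ => C₂ * (K : ℝ) ^ (2 * q * (1 - μ) / μ)))) ∧
    -- the root of the mean, and the mean of the root
    (∃ c : ℝ, 0 < c ∧ ∀ s₀ : ℝ, 0 < s₀ →
      Tendsto (fun K : ℕ => √(∫ s, herfindahl s ∂(sizeLaw s₀ μ K)) / (K : ℝ) ^ ((1 - μ) / 2))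
        atTop (𝓝 c)) ∧
    (∃ c : ℝ, 0 < c ∧ ∀ s₀ : ℝ, 0 < s₀ →
      Tendsto (fun K : ℕ => (∫ s, √(herfindahl s) ∂(sizeLaw s₀ μ K)) / (K : ℝ) ^ ((1 - μ) / μ))
        atTop (𝓝 c)) := by
  have hμ0 : 0 < μ := by linarith
  refine ⟨fun q hq s₀ hs K => integrable_herfindahl_rpow s₀ μ q hs hμ0 hq K, ?_, ?_, ?_⟩
  · intro q hq0 hqne
    rcases hqne.lt_or_gt with hq | hq
    · have hexp := (lt_rpow_exponent_iff hμ1).mpr hq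
      -- The dominated term is absorbed by the error, so its coefficient is arbitrary; 0 is taken
      -- here and, for the other term, in the opposite case.
      refine ⟨0, stableCoeff μ q, fun s₀ hs => ?_, fun h => absurd h hq.not_gt, fun _ =>
        ⟨stableCoeff_pos hμ1 hμ2 hq0 hq, isLittleO_natCast_rpow_rpow hexp, fun s₀ hs =>
          isEquivalent_herfindahlMoment_of_lt hμ1 hμ2 hq0 hq hs⟩⟩
      simp only [max_eq_right hexp.le, zero_mul, zero_add]
      exact (isEquivalent_herfindahlMoment_of_lt hμ1 hμ2 hq0 hq hs).isLittleO.trans_isBigO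
        (Asymptotics.isBigO_const_mul_self _ _ _)
    · have hexp := (rpow_exponent_lt_iff hμ1).mpr hq
      refine ⟨singleJumpCoeff μ q, 0, fun s₀ hs => ?_, fun _ =>
        ⟨singleJumpCoeff_pos hμ1 hμ2 hq, isLittleO_natCast_rpow_rpow hexp, fun s₀ hs =>
          isEquivalent_herfindahlMoment_of_gt hμ1 hμ2 hq hs⟩, fun h => absurd h hq.not_gt⟩
      simp only [max_eq_left hexp.le, zero_mul, add_zero]
      exact (isEquivalent_herfindahlMoment_of_gt hμ1 hμ2 hq hs).isLittleO.trans_isBigO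
        (Asymptotics.isBigO_const_mul_self _ _ _)
  -- The mean of the index is the case q = 1, above the threshold because μ < 2.
  · have hq : μ / 2 < 1 := by linarith
    refine ⟨√(singleJumpCoeff μ 1), Real.sqrt_pos.mpr (singleJumpCoeff_pos hμ1 hμ2 hq),
      fun s₀ hs => ?_⟩
    have h := (tendsto_herfindahlMoment_mul_rpow_of_gt hμ1 hμ2 hq).sqrt
    refine h.congr fun K => ?_
    rw [← herfindahlMoment_eq_scale_one s₀ μ 1 hs hμ0, Real.sqrt_mul' _ (by positivity),
      div_eq_mul_inv, ← Real.rpow_neg K.cast_nonneg, Real.sqrt_eq_rpow ((K : ℝ) ^ (μ - 1)),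
      ← Real.rpow_mul K.cast_nonneg]
    simp only [herfindahlMoment, Real.rpow_one]
    ring_nf
  -- The mean of the root is the case q = 1/2, below the threshold because μ > 1; this is why the
  -- two ratios scale differently.
  · have hq : 1 / 2 < μ / 2 := by linarith
    refine ⟨stableCoeff μ (1 / 2), stableCoeff_pos hμ1 hμ2 one_half_pos hq, fun s₀ hs => ?_⟩
    refine (tendsto_herfindahlMoment_mul_rpow_of_lt hμ1 hμ2 one_half_pos hq).congr fun K => ?_
    rw [← herfindahlMoment_eq_scale_one s₀ μ (1 / 2) hs hμ0, div_eq_mul_inv (∫ _, _ ∂_),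
      ← Real.rpow_neg K.cast_nonneg]
    simp only [herfindahlMoment, Real.sqrt_eq_rpow]
    ring_nf
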